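/- **Theorem (local discrete $H^1$- and Poincaré–Friedrichs inequalities).** Let $d\ge 2$ and let $K\subset\mathbb R^d$ be a polygonal/polyhedral element, i.e. a finite union of nondegenerate closed simplices with connected interior, with diameter $h_K$ and outward unit normal $\boldsymbol n$. Let $W(K)\subset H^1(K)$, $\boldsymbol V(K)\subset\{\boldsymbol v\in H(\mathrm{div},K):\boldsymbol v\cdot\boldsymbol n|_{\partial K}\in L^2(\partial K)\}$ and $M(\partial K)\subset L^2(\partial K)$ be finite-dimensional subspaces, and put $\mathrm{tr}(\boldsymbol v,w):=(\boldsymbol v\cdot\boldsymbol n+w)|_{\partial K}$. Suppose that $\boldsymbol V(K)\times W(K)$ admits an $M(\partial K)$-decomposition: $\mathrm{tr}(\boldsymbol V(K)\times W(K))\subset M(\partial K)$, and there are subspaces $\widetilde{\boldsymbol V}\subset\boldsymbol V(K)$, $\widetilde W\subset W(K)$ with $\nabla W(K)\subset\widetilde{\boldsymbol V}$ and $\nabla\cdot\boldsymbol V(K)\subset\widetilde W$ such that $\mathrm{tr}:\widetilde{\boldsymbol V}^\perp\times\widetilde W^\perp\to M(\partial K)$ is an isomorphism, where $\widetilde{\boldsymbol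 V}^\perp$, $\widetilde W^\perp$ are the $L^2(K)$-orthogonal complements of $\widetilde{\boldsymbol V}$ in $\boldsymbol V(K)$ and of $\widetilde W$ in $W(K)$. Let $M_S(\partial K)\subset M(\partial K)$ be any subspace, with $L^2(\partial K)$-orthogonal projection $P_{M_S}$, such that $$\dim M_S(\partial K)=\dim\widetilde W^\perp=\dim W(K)-\dim\nabla\cdot\boldsymbol V(K),\qquad \|P_{M_S}(\cdot)\|_{\partial K}\ \text{is a norm on}\ \widetilde W^\perp .$$ Then there is a constant $C>0$, depending only on $K$ and the spaces $\boldsymbol V(K),W(K),M(\partial K),M_S(\partial K)$, with the following property. Let $\mathrm c$ be any measurable, symmetric matrix-valued function on $K$ such that $\mathrm c$ and $\mathrm c^{-1}$ are bounded and uniformly positive definite, let $\lambda^{\max}_{\mathrm c}(K)$ be the $L^\infty(K)$-norm of its largest eigenvalue, and put $\|\boldsymbol q\|_{\mathrm c,K}^2:=(\mathrm c\,\boldsymbol q,\boldsymbol q)_K$. If $u_h\in W(K)$, $\widehat u_h\in M(\partial K)$ and $\boldsymbol q_h\in\boldsymbol V(K)$ satisfy $$(\mathrm c\,\boldsymbol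 q_h,\boldsymbol v)_K=(u_h,\nabla\cdot\boldsymbol v)_K-\langle\widehat u_h,\boldsymbol v\cdot\boldsymbol n\rangle_{\partial K}\qquad\forall\,\boldsymbol v\in\boldsymbol V(K),$$ then, with $\Theta_K:=\lambda^{\max}_{\mathrm c}(K)\,\|\boldsymbol q_h\|_{\mathrm c,K}^2+h_K^{-1}\|P_{M_S}(u_h-\widehat u_h)\|_{\partial K}^2$ and with $\overline{\widehat u_h}$ the average of $\widehat u_h$ on $\partial K$, $$\|\nabla u_h\|_K^2+h_K^{-1}\|u_h-\widehat u_h\|_{\partial K}^2\le C\,\Theta_K,$$ $$h_K^{-2}\Big(\|u_h-\overline{\widehat u_h}\|_K^2+h_K\|\widehat u_h-\overline{\widehat u_h}\|_{\partial K}^2\Big)\le C\,\Theta_K .$$ Moreover, $C$ does not depend on the size or position of the element: the same $C$ serves for every image of $K$ under a similarity transformation $\Phi(x)=b+\rho Rx$ ($\rho>0$, $R$ orthogonal, $b\in\mathbb R^d$), equipped with the transported spaces, consisting of the functions $w\circ\Phi^{-1}$, $\widehat w\circ\Phi^{-1}$ and the vector fields $R(\boldsymbol v\circ\Phi^{-1})$.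 -/

import Mathlib

open MeasureTheory Filter Topology
open scoped ContDiff

noncomputable section

namespace HDG

/-- Euclidean `d`-space. -/
abbrev E (d : ℕ) : Type := EuclideanSpace ℝ (Fin d)

variable {d : ℕ}

/-! ### Elements -/

/-- A (closed) polygonal / polyhedral element: a finite union of nondegenerate closed simplices
whose interior is connected (in particular nonempty). It need be neither convex nor a simplex. -/
def IsPolyhedralElement (K : Set (E d)) : Prop :=
  (∃ (n : ℕ) (p : Fin n → Fin (d + 1) → E d),
    (∀ i, AffineIndependent ℝ (p i)) ∧ K = ⋃ i, convexHull ℝ (Set.range (p i))) ∧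
  IsConnected (interior K)

/-- The `(d-1)`-dimensional surface measure on `∂K`; `μHE` is the Hausdorff measure normalized so
as to agree with Lebesgue measure on `(d-1)`-dimensional Euclidean spaces. -/
def surf (K : Set (E d)) : Measure (E d) := (μHE[d - 1]).restrict (frontier K)

/-- `L²(K)`. -/
abbrev L2 (K : Set (E d)) := Lp ℝ 2 (volume.restrict K)

/-- `L²(K)^d`. -/
abbrev L2Vec (K : Set (E d)) := Lp (E d) 2 (volume.restrict K)

/-- `L²(∂K)`. -/
abbrev L2Bd (K : Set (E d)) := Lp ℝ 2 (surf K)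

/-! ### `H¹(K)` and traces -/

/-- `G` is the weak gradient of `w` in the interior of `K`. -/
def HasWeakGradient (K : Set (E d)) (w : L2 K) (G : L2Vec K) : Prop :=
  ∀ φ : E d → ℝ, ContDiff ℝ ∞ φ → HasCompactSupport φ → tsupport φ ⊆ interior K →
    ∀ e : E d, ∫ x in K, w x * fderiv ℝ φ x e = - ∫ x in K, inner ℝ (G x) e * φ x

/-- `g` is the trace of `w` on `∂K`: at almost every boundary point `x`, the mean of `|w - g x|`
over `K ∩ B(x, r)` tends to `0` as `r → 0`. -/
def HasTrace (K : Set (E d)) (w : L2 K) (g : L2Bd K) : Prop :=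
  ∀ᵐ x ∂(surf K), Tendsto
    (fun r : ℝ => ⨍ y in Metric.closedBall x r, |w y - g x| ∂(volume.restrict K))
    (𝓝[>] 0) (𝓝 0)

lemma integrable_mul_test {K : Set (E d)} (w : L2 K) {ψ : E d → ℝ} (hψ : Continuous ψ)
    (hc : HasCompactSupport ψ) : Integrable (fun x => w x * ψ x) (volume.restrict K) :=
  (Lp.memLp w).integrable_mul (q := 2) (hψ.memLp_of_hasCompactSupport hc)

lemma integrable_inner_mul_test {K : Set (E d)} (G : L2Vec K) (e : E d) {ψ : E d → ℝ}
    (hψ : Continuous ψ) (hc : HasCompactSupport ψ) :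
    Integrable (fun x => inner ℝ (G x) e * ψ x) (volume.restrict K) :=
  ((Lp.memLp G).inner_const e).integrable_mul (q := 2) (hψ.memLp_of_hasCompactSupport hc)

lemma HasWeakGradient.add {K : Set (E d)} {w₁ w₂ : L2 K} {G₁ G₂ : L2Vec K}
    (h₁ : HasWeakGradient K w₁ G₁) (h₂ : HasWeakGradient K w₂ G₂) :
    HasWeakGradient K (w₁ + w₂) (G₁ + G₂) := by
  intro φ hφ hc hs e
  have hd : Continuous (fun x => fderiv ℝ φ x e) :=
    (hφ.continuous_fderiv (by simp)).clm_apply continuous_const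
  have hdc : HasCompactSupport (fun x => fderiv ℝ φ x e) := hc.fderiv_apply (𝕜 := ℝ) e
  have a : ∫ x in K, (w₁ + w₂ : L2 K) x * fderiv ℝ φ x e
      = ∫ x in K, (w₁ x * fderiv ℝ φ x e + w₂ x * fderiv ℝ φ x e) := by
    refine integral_congr_ae ?_
    filter_upwards [Lp.coeFn_add w₁ w₂] with x hx
    rw [hx, Pi.add_apply, add_mul]
  have b : ∫ x in K, inner ℝ ((G₁ + G₂ : L2Vec K) x) e * φ x
      = ∫ x in K, (inner ℝ (G₁ x) e * φ x + inner ℝ (G₂ x) e * φ x) := by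
    refine integral_congr_ae ?_
    filter_upwards [Lp.coeFn_add G₁ G₂] with x hx
    rw [hx, Pi.add_apply, inner_add_left, add_mul]
  rw [a, b, integral_add (integrable_mul_test w₁ hd hdc) (integrable_mul_test w₂ hd hdc),
    integral_add (integrable_inner_mul_test G₁ e hφ.continuous hc)
      (integrable_inner_mul_test G₂ e hφ.continuous hc), h₁ φ hφ hc hs e, h₂ φ hφ hc hs e]
  ring

lemma HasWeakGradient.smul {K : Set (E d)} {w : L2 K} {G : L2Vec K} (a : ℝ)
    (h : HasWeakGradient K w G) : HasWeakGradient K (a • w) (a • G) := by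
  intro φ hφ hc hs e
  have h1 : ∫ x in K, (a • w : L2 K) x * fderiv ℝ φ x e
      = ∫ x in K, a * (w x * fderiv ℝ φ x e) := by
    refine integral_congr_ae ?_
    filter_upwards [Lp.coeFn_smul a w] with x hx
    rw [hx, Pi.smul_apply, smul_eq_mul, mul_assoc]
  have h2 : ∫ x in K, inner ℝ ((a • G : L2Vec K) x) e * φ x
      = ∫ x in K, a * (inner ℝ (G x) e * φ x) := by
    refine integral_congr_ae ?_
    filter_upwards [Lp.coeFn_smul a G] with x hx
    rw [hx, Pi.smul_apply, real_inner_smul_left, mul_assoc]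
  rw [h1, h2, integral_const_mul, integral_const_mul, h φ hφ hc hs e]
  ring

lemma HasWeakGradient.zero (K : Set (E d)) : HasWeakGradient K 0 0 := by
  have h : HasWeakGradient K ((0 : ℝ) • (0 : L2 K)) ((0 : ℝ) • (0 : L2Vec K)) := by
    intro φ hφ hc hs e
    have h1 : ∫ x in K, ((0 : ℝ) • (0 : L2 K)) x * fderiv ℝ φ x e = ∫ x in K, (0 : ℝ) := by
      refine integral_congr_ae ?_
      filter_upwards [Lp.coeFn_smul (0 : ℝ) (0 : L2 K)] with x hx
      rw [hx]; simp
    have h2 : ∫ x in K, inner ℝ (((0 : ℝ) • (0 : L2Vec K)) x) e * φ x = ∫ x in K, (0 : ℝ) := by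
      refine integral_congr_ae ?_
      filter_upwards [Lp.coeFn_smul (0 : ℝ) (0 : L2Vec K)] with x hx
      rw [hx]; simp
    rw [h1, h2]; simp
  simpa using h

lemma integrableOn_ball {K : Set (E d)} (w : L2 K) (t : ℝ) (x : E d) (r : ℝ) :
    Integrable (fun y => |w y - t|) ((volume.restrict K).restrict (Metric.closedBall x r)) := by
  have hfin : IsFiniteMeasure ((volume.restrict K).restrict (Metric.closedBall x r)) := by
    refine ⟨?_⟩
    rw [Measure.restrict_apply_univ]
    exact lt_of_le_of_lt (Measure.restrict_apply_le _ _)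
      (isCompact_closedBall x r).measure_lt_top
  have hw : Integrable (fun y => w y)
      ((volume.restrict K).restrict (Metric.closedBall x r)) :=
    ((Lp.memLp w).mono_measure Measure.restrict_le_self).integrable (by norm_num)
  exact (hw.sub (integrable_const t)).abs

lemma HasTrace.add {K : Set (E d)} {w₁ w₂ : L2 K} {g₁ g₂ : L2Bd K}
    (h₁ : HasTrace K w₁ g₁) (h₂ : HasTrace K w₂ g₂) : HasTrace K (w₁ + w₂) (g₁ + g₂) := by
  filter_upwards [h₁, h₂, Lp.coeFn_add g₁ g₂] with x a₁ a₂ hg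
  have hlim := a₁.add a₂
  rw [add_zero] at hlim
  refine squeeze_zero (fun r => ?_) (fun r => ?_) hlim
  · rw [average_eq]
    exact smul_nonneg (by positivity) (integral_nonneg fun y => abs_nonneg _)
  · rw [average_eq, average_eq, average_eq, ← smul_add,
      ← integral_add (integrableOn_ball w₁ _ x r) (integrableOn_ball w₂ _ x r)]
    refine smul_le_smul_of_nonneg_left ?_ (by positivity)
    refine integral_mono_ae (integrableOn_ball _ _ x r)
      ((integrableOn_ball w₁ _ x r).add (integrableOn_ball w₂ _ x r)) ?_
    filter_upwards [ae_restrict_of_ae (s := Metric.closedBall x r) (Lp.coeFn_add w₁ w₂)] with y hy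
    rw [hy, hg, Pi.add_apply, Pi.add_apply, add_sub_add_comm]
    exact abs_add_le _ _

lemma HasTrace.smul {K : Set (E d)} {w : L2 K} {g : L2Bd K} (a : ℝ)
    (h : HasTrace K w g) : HasTrace K (a • w) (a • g) := by
  filter_upwards [h, Lp.coeFn_smul a g] with x hx hg
  have hlim := hx.const_mul |a|
  rw [mul_zero] at hlim
  refine hlim.congr fun r => ?_
  rw [average_eq, average_eq, smul_eq_mul, smul_eq_mul, mul_left_comm, ← integral_const_mul]
  congr 1
  refine integral_congr_ae ?_
  filter_upwards [ae_restrict_of_ae (s := Metric.closedBall x r) (Lp.coeFn_smul a w)] with y hy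
  rw [hy, hg, Pi.smul_apply, Pi.smul_apply, smul_eq_mul, smul_eq_mul, ← mul_sub, abs_mul]

lemma HasTrace.zero (K : Set (E d)) : HasTrace K 0 0 := by
  filter_upwards [Lp.coeFn_zero ℝ 2 (surf K)] with x hg
  refine tendsto_const_nhds.congr fun r => ?_
  rw [average_eq]
  have : ∫ y in Metric.closedBall x r, |(0 : L2 K) y - (0 : L2Bd K) x| ∂(volume.restrict K)
      = ∫ y in Metric.closedBall x r, (0 : ℝ) ∂(volume.restrict K) := by
    refine integral_congr_ae ?_
    filter_upwards [ae_restrict_of_ae (s := Metric.closedBall x r)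
      (Lp.coeFn_zero ℝ 2 (volume.restrict K))] with y hy
    rw [hy, hg]; simp
  rw [this]; simp

/-- The Sobolev space `H¹(K)`, each function being listed together with its weak gradient and its
trace: the triples `(w, ∇w, w|_∂K)`. -/
def H1 (K : Set (E d)) : Submodule ℝ (L2 K × L2Vec K × L2Bd K) where
  carrier := {p | HasWeakGradient K p.1 p.2.1 ∧ HasTrace K p.1 p.2.2}
  add_mem' h₁ h₂ := ⟨h₁.1.add h₂.1, h₁.2.add h₂.2⟩
  zero_mem' := ⟨HasWeakGradient.zero K, HasTrace.zero K⟩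
  smul_mem' a _ h := ⟨h.1.smul a, h.2.smul a⟩

/-- The function itself. -/
def H1.val {K : Set (E d)} : H1 K →ₗ[ℝ] L2 K :=
  LinearMap.fst ℝ _ _ ∘ₗ (H1 K).subtype

/-- The gradient `∇w`. -/
def H1.grad {K : Set (E d)} : H1 K →ₗ[ℝ] L2Vec K :=
  LinearMap.fst ℝ _ _ ∘ₗ LinearMap.snd ℝ _ _ ∘ₗ (H1 K).subtype

/-- The trace `w|_∂K`. -/
def H1.trace {K : Set (E d)} : H1 K →ₗ[ℝ] L2Bd K :=
  LinearMap.snd ℝ _ _ ∘ₗ LinearMap.snd ℝ _ _ ∘ₗ (H1 K).subtype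

/-! ### `H(div, K)` and normal traces -/

/-- The vector fields of `H(div, K)` with normal trace in `L²(∂K)`, each listed together with its
divergence and its normal trace: the triples `(v, ∇·v, v·n|_∂K)`. As usual, these are defined by
Green's formula `(v, ∇w)_K + (∇·v, w)_K = ⟨v·n, w⟩_∂K` for all `w ∈ H¹(K)`. -/
def Hdiv (K : Set (E d)) : Submodule ℝ (L2Vec K × L2 K × L2Bd K) where
  carrier := {p | ∀ w : H1 K, inner ℝ p.1 (H1.grad w) + inner ℝ p.2.1 (H1.val w)
    = inner ℝ p.2.2 (H1.trace w)}
  add_mem' {p q} hp hq w := by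
    have h₁ := hp w
    have h₂ := hq w
    simp only [Prod.fst_add, Prod.snd_add, inner_add_left]
    linarith
  zero_mem' w := by simp
  smul_mem' a p hp w := by
    have h := hp w
    simp only [Prod.smul_fst, Prod.smul_snd, real_inner_smul_left]
    rw [← mul_add, h]

/-- The vector field itself. -/
def Hdiv.val {K : Set (E d)} : Hdiv K →ₗ[ℝ] L2Vec K :=
  LinearMap.fst ℝ _ _ ∘ₗ (Hdiv K).subtype

/-- The divergence `∇·v`. -/
def Hdiv.div {K : Set (E d)} : Hdiv K →ₗ[ℝ] L2 K :=
  LinearMap.fst ℝ _ _ ∘ₗ LinearMap.snd ℝ _ _ ∘ₗ (Hdiv K).subtype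

/-- The normal trace `v·n|_∂K`, with `n` the outward unit normal. -/
def Hdiv.ntrace {K : Set (E d)} : Hdiv K →ₗ[ℝ] L2Bd K :=
  LinearMap.snd ℝ _ _ ∘ₗ LinearMap.snd ℝ _ _ ∘ₗ (Hdiv K).subtype

/-! ### Local spaces, M-decompositions, stabilization subspaces -/

/-- An element `K` with finite-dimensional local spaces `V(K)`, `W(K)`, `M(∂K)` and a candidate
`M_S(∂K)` for the stabilization subspace. -/
structure LocalSpaces (d : ℕ) where
  K : Set (E d)
  V : Submodule ℝ (Hdiv K)
  W : Submodule ℝ (H1 K)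
  M : Submodule ℝ (L2Bd K)
  MS : Submodule ℝ (L2Bd K)
  finV : FiniteDimensional ℝ V
  finW : FiniteDimensional ℝ W
  finM : FiniteDimensional ℝ M
  finMS : FiniteDimensional ℝ MS

attribute [instance] LocalSpaces.finV LocalSpaces.finW LocalSpaces.finM LocalSpaces.finMS

/-- The combined trace `tr (v, w) = (v·n + w)|_∂K`. -/
def tr {K : Set (E d)} (p : Hdiv K × H1 K) : L2Bd K := Hdiv.ntrace p.1 + H1.trace p.2

/-- The `L²(K)`-orthogonal complement of `Vt` in `V`. -/
def perpV {K : Set (E d)} (V Vt : Submodule ℝ (Hdiv K)) : Submodule ℝ (Hdiv K) :=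
  V ⊓ ((Vt.map Hdiv.val)ᗮ).comap Hdiv.val

/-- The `L²(K)`-orthogonal complement of `Wt` in `W`. -/
def perpW {K : Set (E d)} (W Wt : Submodule ℝ (H1 K)) : Submodule ℝ (H1 K) :=
  W ⊓ ((Wt.map H1.val)ᗮ).comap H1.val

/-- The subspace `Vt × Wt` of `V × W` provides an `M(∂K)`-decomposition of `V × W`. The last clause
says that the linear map `tr : Vt^⊥ × Wt^⊥ → M` is (well defined and) bijective. -/
structure IsMDecomposition (S : LocalSpaces d) (Vt : Submodule ℝ (Hdiv S.K))
    (Wt : Submodule ℝ (H1 S.K)) : Prop where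
  le_V : Vt ≤ S.V
  le_W : Wt ≤ S.W
  tr_mem : ∀ v ∈ S.V, ∀ w ∈ S.W, tr (v, w) ∈ S.M
  grad_mem : S.W.map H1.grad ≤ Vt.map Hdiv.val
  div_mem : S.V.map Hdiv.div ≤ Wt.map H1.val
  tr_bij : Set.BijOn tr ((perpV S.V Vt : Set (Hdiv S.K)) ×ˢ (perpW S.W Wt : Set (H1 S.K)))
    (S.M : Set (L2Bd S.K))

/-- `M_S` is a stabilization subspace of `M(∂K)`: `dim M_S = dim Wt^⊥ = dim W - dim ∇·V`, and
`‖P_{M_S}(·)‖_∂K` is a norm on `Wt^⊥`, i.e. this seminorm is definite there. -/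
structure IsStabilizationSubspace (S : LocalSpaces d) (Wt : Submodule ℝ (H1 S.K)) : Prop where
  le_M : S.MS ≤ S.M
  dim_eq : Module.finrank ℝ S.MS = Module.finrank ℝ (perpW S.W Wt)
  dim_eq' : (Module.finrank ℝ (perpW S.W Wt) : ℤ)
    = Module.finrank ℝ S.W - Module.finrank ℝ (S.V.map Hdiv.div)
  isNorm : ∀ w ∈ perpW S.W Wt, ‖S.MS.starProjection (H1.trace w)‖ = 0 → w = 0

/-! ### Similar elements -/

/-- The similarity transformation `x ↦ b + ρ R x`. -/
def similarity (ρ : ℝ) (R : E d ≃ₗᵢ[ℝ] E d) (b : E d) (x : E d) : E d := b + ρ • R x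

/-- `w'` is the push-forward `w ∘ Φ⁻¹` of `w` along `Φ x = b + ρ R x`. -/
def IsPushW (ρ : ℝ) (R : E d ≃ₗᵢ[ℝ] E d) (b : E d) {K K' : Set (E d)} (w : H1 K) (w' : H1 K') :
    Prop :=
  (∀ᵐ x ∂(volume.restrict K), H1.val w' (similarity ρ R b x) = H1.val w x) ∧
  (∀ᵐ x ∂(volume.restrict K), H1.grad w' (similarity ρ R b x) = ρ⁻¹ • R (H1.grad w x)) ∧
  (∀ᵐ x ∂(surf K), H1.trace w' (similarity ρ R b x) = H1.trace w x)

/-- `v'` is the push-forward `R (v ∘ Φ⁻¹)` of the vector field `v` along `Φ x = b + ρ R x`. -/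
def IsPushV (ρ : ℝ) (R : E d ≃ₗᵢ[ℝ] E d) (b : E d) {K K' : Set (E d)} (v : Hdiv K)
    (v' : Hdiv K') : Prop :=
  (∀ᵐ x ∂(volume.restrict K), Hdiv.val v' (similarity ρ R b x) = R (Hdiv.val v x)) ∧
  (∀ᵐ x ∂(volume.restrict K), Hdiv.div v' (similarity ρ R b x) = ρ⁻¹ * Hdiv.div v x) ∧
  (∀ᵐ x ∂(surf K), Hdiv.ntrace v' (similarity ρ R b x) = Hdiv.ntrace v x)

/-- `m'` is the push-forward `m ∘ Φ⁻¹` of the boundary function `m` along `Φ x = b + ρ R x`. -/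
def IsPushM (ρ : ℝ) (R : E d ≃ₗᵢ[ℝ] E d) (b : E d) {K K' : Set (E d)} (m : L2Bd K)
    (m' : L2Bd K') : Prop :=
  ∀ᵐ x ∂(surf K), m' (similarity ρ R b x) = m x

/-- `S'` is the image of `S` under the similarity transformation `Φ x = b + ρ R x`: the element is
`K' = Φ(K)`, and the spaces consist of the functions `w' = w ∘ Φ⁻¹` on `K'` and on `∂K'` and of the
vector fields `v' = R (v ∘ Φ⁻¹)`, whose derivatives and (normal) traces transform accordingly. -/
structure IsSimilarityImage (ρ : ℝ) (R : E d ≃ₗᵢ[ℝ] E d) (b : E d) (S S' : LocalSpaces d) :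
    Prop where
  image_K : S'.K = similarity ρ R b '' S.K
  V_fwd : ∀ v ∈ S.V, ∃ v' ∈ S'.V, IsPushV ρ R b v v'
  V_bwd : ∀ v' ∈ S'.V, ∃ v ∈ S.V, IsPushV ρ R b v v'
  W_fwd : ∀ w ∈ S.W, ∃ w' ∈ S'.W, IsPushW ρ R b w w'
  W_bwd : ∀ w' ∈ S'.W, ∃ w ∈ S.W, IsPushW ρ R b w w'
  M_fwd : ∀ m ∈ S.M, ∃ m' ∈ S'.M, IsPushM ρ R b m m'
  M_bwd : ∀ m' ∈ S'.M, ∃ m ∈ S.M, IsPushM ρ R b m m'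
  MS_fwd : ∀ m ∈ S.MS, ∃ m' ∈ S'.MS, IsPushM ρ R b m m'
  MS_bwd : ∀ m' ∈ S'.MS, ∃ m ∈ S.MS, IsPushM ρ R b m m'

/-! ### The inequalities -/

/-- The tensor `c` on `K`: measurable, symmetric, with `c` and `c⁻¹` bounded and uniformly positive
definite. -/
def IsAdmissibleTensor (K : Set (E d)) (c : E d → Matrix (Fin d) (Fin d) ℝ) : Prop :=
  (∀ i j, AEMeasurable (fun x => c x i j) (volume.restrict K)) ∧
  (∀ᵐ x ∂(volume.restrict K), (c x).IsSymm) ∧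
  ∃ α β : ℝ, 0 < α ∧ ∀ᵐ x ∂(volume.restrict K), ∀ ξ : E d,
    α * ‖ξ‖ ^ 2 ≤ inner ℝ (Matrix.toEuclideanLin (c x) ξ) ξ ∧
    inner ℝ (Matrix.toEuclideanLin (c x) ξ) ξ ≤ β * ‖ξ‖ ^ 2

/-- `(c q, v)_K`. -/
def cForm (K : Set (E d)) (c : E d → Matrix (Fin d) (Fin d) ℝ) (q v : L2Vec K) : ℝ :=
  ∫ x in K, inner ℝ (Matrix.toEuclideanLin (c x) (q x)) (v x)

/-- `λ_c^max(K)`: the `L^∞(K)`-norm of the maximum eigenvalue of `c`. -/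
def lambdaMax (K : Set (E d)) (c : E d → Matrix (Fin d) (Fin d) ℝ) : ℝ :=
  (eLpNorm (fun x => sSup (spectrum ℝ (c x))) ⊤ (volume.restrict K)).toReal

/-- The discrete constitutive relation
`(c q, v)_K = (u, ∇·v)_K - ⟨û, v·n⟩_∂K` for all `v ∈ V(K)`. -/
def ConstitutiveRelation (S : LocalSpaces d) (c : E d → Matrix (Fin d) (Fin d) ℝ)
    (q : Hdiv S.K) (u : H1 S.K) (uhat : L2Bd S.K) : Prop :=
  ∀ v ∈ S.V, cForm S.K c (Hdiv.val q) (Hdiv.val v)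
    = inner ℝ (H1.val u) (Hdiv.div v) - inner ℝ uhat (Hdiv.ntrace v)

/-- `|(u, û)|²_{1,K} = ‖∇u‖²_K + h_K⁻¹ ‖u - û‖²_∂K`, with `h_K` the diameter of `K`. -/
def seminormH1Sq {K : Set (E d)} (u : H1 K) (uhat : L2Bd K) : ℝ :=
  ‖H1.grad u‖ ^ 2 + (Metric.diam K)⁻¹ * ‖H1.trace u - uhat‖ ^ 2

/-- `|(u, û)|²_{PF,K} = ‖u - a‖²_K + h_K ‖û - a‖²_∂K`, with `a` the average of `û` on `∂K`. -/
def seminormPFSq {K : Set (E d)} (u : H1 K) (uhat : L2Bd K) : ℝ :=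
  (∫ x in K, (H1.val u x - ⨍ y, uhat y ∂(surf K)) ^ 2)
    + Metric.diam K * ∫ x, (uhat x - ⨍ y, uhat y ∂(surf K)) ^ 2 ∂(surf K)

/-- `Θ_K = λ_c^max(K) ‖q‖²_{c,K} + h_K⁻¹ ‖P_{M_S}(u - û)‖²_∂K`. -/
def Theta (S : LocalSpaces d) (c : E d → Matrix (Fin d) (Fin d) ℝ)
    (q : Hdiv S.K) (u : H1 S.K) (uhat : L2Bd S.K) : ℝ :=
  lambdaMax S.K c * cForm S.K c (Hdiv.val q) (Hdiv.val q)
    + (Metric.diam S.K)⁻¹ * ‖S.MS.starProjection (H1.trace u - uhat)‖ ^ 2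

end HDG

end

noncomputable section

namespace HDG

variable {d : ℕ}

/-! ### Linear maps on finite-dimensional spaces -/

/-! The estimate is a kernel statement on a finite-dimensional space, made quantitative by
compactness and then scaled. By the constitutive relation, the residual `v ↦ (u, ∇·v) - ⟨û, v·n⟩`
equals `(c q, v)`, and weighted Cauchy–Schwarz (`cForm_sq_le`) bounds its square by `λ_max ‖q‖_c²
‖v‖²`. Hence it is enough to control `(u, û)` by the dual norm of the residual together with
`P_{M_S}(u - û)`.

Suppose both vanish. Green's formula turns the zero residual into `⟨u - û, v·n⟩ = (∇u, v)` on `V`.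
Write `u - û = v·n + w` with `v ∈ Ṽ^⊥`, `w ∈ W̃^⊥`. The inclusions `∇W ⊂ Ṽ` and `∇·V ⊂ W̃` make
`v·n` orthogonal both to `w` and to `u - û`, so `v·n = 0`; definiteness of `P_{M_S}` on `W̃^⊥` then
gives `w = 0`. Thus `u = û` on the boundary, and testing with the element of `Ṽ` equal to `∇u` gives
`∇u = 0` (`IsMDecomposition.grad_eq_zero_and_trace_eq`). As the interior is connected, `u` is
constant, and so `û` equals its own average (`ae_eq_const_of_grad_eq_zero`).

So everything to be estimated vanishes on the kernel of the data map, and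
`exists_sq_norm_le_of_residual` yields a constant on `K`. For a similar element only the residual is
pulled back, never the tensor; all terms of the two inequalities carry the same factor `ρ^(d-2)`
(`scaled_bounds`), so the constant does not see `ρ`. -/

/-- A linear map with finite-dimensional domain is controlled by every linear map with smaller
kernel. -/
lemma exists_norm_le_mul_norm_of_ker_le {X Y Z : Type*} [AddCommGroup X] [Module ℝ X]
    [FiniteDimensional ℝ X] [NormedAddCommGroup Y] [NormedSpace ℝ Y] [NormedAddCommGroup Z]
    [NormedSpace ℝ Z] (T : X →ₗ[ℝ] Y) (N : X →ₗ[ℝ] Z) (h : T.ker ≤ N.ker) :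
    ∃ C : ℝ, 0 ≤ C ∧ ∀ x, ‖N x‖ ≤ C * ‖T x‖ := by
  -- `N` factors through the range of `T`, which is finite-dimensional, so the factor `L` is
  -- automatically continuous and its operator norm is the constant.
  let L : T.range →ₗ[ℝ] Z := (T.ker.liftQ N h) ∘ₗ T.quotKerEquivRange.symm.toLinearMap
  have hL (x : X) : L ⟨T x, x, rfl⟩ = N x := by
    have : T.quotKerEquivRange.symm ⟨T x, x, rfl⟩ = T.ker.mkQ x := by
      rw [LinearEquiv.symm_apply_eq]; rfl
    simp [L, this]
  refine ⟨‖L.toContinuousLinearMap‖, ContinuousLinearMap.opNorm_nonneg _, fun x => ?_⟩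
  have := L.toContinuousLinearMap.le_opNorm ⟨T x, x, rfl⟩
  simpa [hL] using this

/-! ### Functions with vanishing weak gradient -/

/-- Mollification: the derivative of `φ_n * f` at `y` is, up to sign, the integral of `f` against
the derivative of a bump centred at `y`, which is an admissible test function. The mollified
functions are therefore constant on the ball, and they converge to `f` almost everywhere. -/
lemma ae_eq_const_on_ball_of_weak_fderiv_eq_zero {f : E d → ℝ} (hf : LocallyIntegrable f volume)
    {U : Set (E d)}
    (h : ∀ φ : E d → ℝ, ContDiff ℝ ∞ φ → HasCompactSupport φ → tsupport φ ⊆ U →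
      ∀ e : E d, ∫ x, f x * fderiv ℝ φ x e = 0)
    {x₀ : E d} {r : ℝ} (hr : 0 < r) (hU : Metric.ball x₀ (2 * r) ⊆ U) :
    ∃ κ : ℝ, ∀ᵐ x ∂(volume : Measure (E d)), x ∈ Metric.ball x₀ r → f x = κ := by
  -- Outer radius at most `r` keeps a bump centred in the `r`-ball inside the `2r`-ball; the fixed
  -- ratio 2 of the radii is what almost everywhere convergence requires.
  let φ : ℕ → ContDiffBump (0 : E d) := fun n =>
    ⟨r / (2 * (n + 1)), r / (n + 1), by positivity, by
      rw [div_lt_div_iff_of_pos_left hr (by positivity) (by positivity)]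
      linarith [n.cast_nonneg (α := ℝ)]⟩
  have hout : Tendsto (fun n => (φ n).rOut) atTop (𝓝 0) := by
    have := tendsto_one_div_add_atTop_nhds_zero_nat (𝕜 := ℝ) |>.const_mul r
    rw [mul_zero] at this
    exact this.congr fun n => by simp [φ, div_eq_mul_inv]
  have hle (n : ℕ) : (φ n).rOut ≤ r :=
    div_le_self hr.le (by linarith [n.cast_nonneg (α := ℝ)])
  have hrat : ∀ᶠ n in atTop, (φ n).rOut ≤ 2 * (φ n).rIn := by
    refine Eventually.of_forall fun n => le_of_eq ?_
    simp only [φ]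
    field_simp
  have hlim := ContDiffBump.ae_convolution_tendsto_right_of_locallyIntegrable (μ := volume)
    hout hrat hf
  set F : ℕ → E d → ℝ := fun n =>
    MeasureTheory.convolution ((φ n).normed volume) f (ContinuousLinearMap.lsmul ℝ ℝ) volume
    with hF
  have hder (n : ℕ) (y : E d) (hy : y ∈ Metric.ball x₀ r) : HasFDerivAt (F n) (0 : E d →L[ℝ] ℝ) y := by
    have hs : ContDiff ℝ ∞ ((φ n).normed (volume : Measure (E d))) := (φ n).contDiff_normed
    have hc : HasCompactSupport ((φ n).normed (volume : Measure (E d))) :=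
      (φ n).hasCompactSupport_normed
    have h1 := hc.hasFDerivAt_convolution_left (ContinuousLinearMap.lsmul ℝ ℝ)
      (hs.of_le (by simp)) hf y
    refine h1.congr_fderiv (ContinuousLinearMap.ext fun e => ?_)
    have hex := (hc.fderiv (𝕜 := ℝ)).convolutionExists_left
      ((ContinuousLinearMap.lsmul ℝ ℝ : ℝ →L[ℝ] ℝ →L[ℝ] ℝ).precompL (E d))
      (hs.continuous_fderiv (by simp)) hf y
    rw [convolution_eq_swap, ContinuousLinearMap.integral_apply hex.integrable_swap]
    set ψ : E d → ℝ := fun s => (φ n).normed volume (y - s) with hψ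
    have hψs : tsupport ψ ⊆ Metric.closedBall y (φ n).rOut := by
      refine closure_minimal (fun s hsupp => ?_) Metric.isClosed_closedBall
      have : y - s ∈ Function.support ((φ n).normed volume) := hsupp
      rw [(φ n).support_normed_eq] at this
      rw [Metric.mem_closedBall, dist_comm, dist_eq_norm]
      exact (mem_ball_zero_iff.1 this).le
    have hψ0 := h ψ (hs.comp (contDiff_const.sub contDiff_id))
      (HasCompactSupport.of_support_subset_isCompact (isCompact_closedBall y (φ n).rOut)
        ((subset_tsupport _).trans hψs))
      (hψs.trans ((Metric.closedBall_subset_ball' (by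
        linarith [hle n, Metric.mem_ball.1 hy])).trans hU)) e
    rw [← neg_eq_zero, ← integral_neg] at hψ0
    rw [zero_apply, ← hψ0]
    refine integral_congr_ae (Eventually.of_forall fun s => ?_)
    have hψd : fderiv ℝ ψ s e = -fderiv ℝ ((φ n).normed volume) (y - s) e := by
      have h2 := ((hs.differentiable (by simp)) (y - s)).hasFDerivAt.comp s
        ((hasFDerivAt_id (𝕜 := ℝ) s).const_sub y)
      have h3 : HasFDerivAt ψ _ s := h2
      simp [h3.fderiv]
    simp [hψd, ContinuousLinearMap.precompL_apply, mul_comm]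
  have hconst (n : ℕ) (y : E d) (hy : y ∈ Metric.ball x₀ r) : F n y = F n x₀ :=
    Metric.isOpen_ball.is_const_of_fderiv_eq_zero (convex_ball x₀ r).isPreconnected
      (fun z hz => (hder n z hz).differentiableAt.differentiableWithinAt)
      (fun z hz => (hder n z hz).fderiv) hy (Metric.mem_ball_self hr)
  -- The sequence at `x₀` is shared by every point of the ball, so its limit exists as soon as one
  -- such point is a convergence point.
  refine ⟨limUnder atTop fun n => F n x₀, ?_⟩
  filter_upwards [hlim] with y hy hyb
  have hy' : Tendsto (fun n => F n y) atTop (𝓝 (f y)) := hy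
  exact (hy'.congr fun n => hconst n y hyb).limUnder_eq.symm

/-- The local constants form a locally constant function on `U`: overlapping balls meet in an open
set of positive measure, hence in a point where both almost everywhere statements hold.
Preconnectedness makes it constant, and the exceptional set is null because it is locally null. -/
lemma ae_eq_const_of_weak_fderiv_eq_zero {f : E d → ℝ} (hf : LocallyIntegrable f volume)
    {U : Set (E d)} (hUo : IsOpen U) (hUc : IsPreconnected U)
    (h : ∀ φ : E d → ℝ, ContDiff ℝ ∞ φ → HasCompactSupport φ → tsupport φ ⊆ U →
      ∀ e : E d, ∫ x, f x * fderiv ℝ φ x e = 0) :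
    ∃ κ : ℝ, ∀ᵐ x ∂(volume : Measure (E d)), x ∈ U → f x = κ := by
  have hloc : ∀ x : U, ∃ r : ℝ, 0 < r ∧ ∃ κ : ℝ, Metric.ball (x : E d) r ⊆ U ∧
      ∀ᵐ y ∂(volume : Measure (E d)), y ∈ Metric.ball (x : E d) r → f y = κ := by
    rintro ⟨x, hx⟩
    obtain ⟨R, hR, hRU⟩ := Metric.isOpen_iff.1 hUo x hx
    have h2 : Metric.ball x (2 * (R / 2)) ⊆ U := by rwa [mul_div_cancel₀ _ two_ne_zero]
    obtain ⟨κ, hκ⟩ := ae_eq_const_on_ball_of_weak_fderiv_eq_zero hf h (half_pos hR) h2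
    exact ⟨R / 2, half_pos hR, κ, (Metric.ball_subset_ball (by linarith)).trans hRU, hκ⟩
  choose r hr g hrU hg using hloc
  have hgl : IsLocallyConstant g := by
    rw [IsLocallyConstant.iff_eventually_eq]
    intro x
    have : ∀ᶠ y : U in 𝓝 x, (y : E d) ∈ Metric.ball (x : E d) (r x) :=
      continuous_subtype_val.continuousAt.eventually (Metric.ball_mem_nhds _ (hr x))
    filter_upwards [this] with y hy
    have hne : (Metric.ball (x : E d) (r x) ∩ Metric.ball (y : E d) (r y)).Nonempty :=
      ⟨y, hy, Metric.mem_ball_self (hr y)⟩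
    have hpos := (Metric.isOpen_ball.inter Metric.isOpen_ball).measure_pos volume hne
    obtain ⟨z, ⟨hz1, hz2⟩, hz3, hz4⟩ := Measure.exists_mem_of_measure_ne_zero_of_ae hpos.ne'
      (ae_restrict_of_ae ((hg x).and (hg y)))
    rw [← hz3 hz1, ← hz4 hz2]
  have : PreconnectedSpace U := Subtype.preconnectedSpace hUc
  obtain ⟨κ, hκ⟩ : ∃ κ, ∀ x : U, g x = κ := by
    rcases isEmpty_or_nonempty U with hE | ⟨⟨x⟩⟩
    · exact ⟨0, fun x => hE.elim x⟩
    · exact ⟨g x, fun y => hgl.apply_eq_of_preconnectedSpace y x⟩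
  refine ⟨κ, ?_⟩
  suffices volume ({x | ¬ (f x = κ)} ∩ U) = 0 by
    rw [ae_iff]
    convert this using 2
    ext x
    simp [and_comm]
  refine measure_null_of_locally_null _ fun x hx => ?_
  refine ⟨_, inter_mem self_mem_nhdsWithin
    (mem_nhdsWithin_of_mem_nhds (Metric.ball_mem_nhds x (hr ⟨x, hx.2⟩))), ?_⟩
  refine measure_mono_null ?_ (ae_iff.1 (hg ⟨x, hx.2⟩))
  rintro z ⟨⟨hz, -⟩, hzb⟩ hc
  exact hz ((hc hzb).trans (hκ _))

/-! ### Geometry of polyhedral elements -/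

lemma IsPolyhedralElement.isCompact {K : Set (E d)} (hK : IsPolyhedralElement K) :
    IsCompact K := by
  obtain ⟨⟨n, p, -, rfl⟩, -⟩ := hK
  exact isCompact_iUnion fun i => (Set.finite_range _).isCompact_convexHull ℝ

lemma interior_simplex_nonempty {p : Fin (d + 1) → E d} (hp : AffineIndependent ℝ p) :
    (interior (convexHull ℝ (Set.range p))).Nonempty := by
  rw [interior_convexHull_nonempty_iff_affineSpan_eq_top]
  exact hp.affineSpan_eq_top_iff_card_eq_finrank_add_one.2 (by simp)

/-- Frontiers of convex sets are Lebesgue null, and a point of a simplex off its frontier is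
interior to the union. Test functions see only the interior, so this is what extends constancy to
almost all of `K`. -/
lemma IsPolyhedralElement.ae_mem_interior {K : Set (E d)} (hK : IsPolyhedralElement K) :
    ∀ᵐ x ∂(volume.restrict K), x ∈ interior K := by
  have hKm := hK.isCompact.measurableSet
  obtain ⟨⟨n, p, hp, hKp⟩, -⟩ := hK
  rw [ae_restrict_iff' hKm]
  have h : ∀ i, ∀ᵐ x ∂(volume : Measure (E d)), x ∉ frontier (convexHull ℝ (Set.range (p i))) :=
    fun i => measure_eq_zero_iff_ae_notMem.1 ((convex_convexHull ℝ _).addHaar_frontier _)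
  filter_upwards [ae_all_iff.2 h] with x hx hxK
  rw [hKp, Set.mem_iUnion] at hxK
  obtain ⟨i, hi⟩ := hxK
  have hint : x ∈ interior (convexHull ℝ (Set.range (p i))) := by
    by_contra hc
    exact hx i ⟨subset_closure hi, hc⟩
  exact interior_mono (hKp ▸ Set.subset_iUnion (fun i => convexHull ℝ (Set.range (p i))) i) hint

/-- A nondegenerate simplex lies in the closure of its interior. The averages defining the trace are
thus never averages over null sets, whose default value 0 would carry no information. -/
lemma IsPolyhedralElement.restrict_closedBall_ne_zero {K : Set (E d)}
    (hK : IsPolyhedralElement K) {x : E d} (hx : x ∈ K) {r : ℝ} (hr : 0 < r) :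
    (volume.restrict K) (Metric.closedBall x r) ≠ 0 := by
  rw [Measure.restrict_apply Metric.isClosed_closedBall.measurableSet]
  obtain ⟨⟨n, p, hp, hKp⟩, -⟩ := hK
  obtain ⟨i, hi⟩ := Set.mem_iUnion.1 (hKp ▸ hx)
  have hcl : x ∈ closure (interior (convexHull ℝ (Set.range (p i)))) := by
    rw [(convex_convexHull ℝ _).closure_interior_eq_closure_of_nonempty_interior
      (interior_simplex_nonempty (hp i))]
    exact subset_closure hi
  have hne := mem_closure_iff_nhds.1 hcl _ (Metric.ball_mem_nhds x hr)
  have hpos := (Metric.isOpen_ball.inter isOpen_interior).measure_pos volume hne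
  refine (hpos.trans_le (measure_mono ?_)).ne'
  refine Set.inter_subset_inter Metric.ball_subset_closedBall (interior_subset.trans ?_)
  rw [hKp]
  exact Set.subset_iUnion (fun i => convexHull ℝ (Set.range (p i))) i

lemma IsPolyhedralElement.diam_pos (hd : 1 ≤ d) {K : Set (E d)} (hK : IsPolyhedralElement K) :
    0 < Metric.diam K := by
  obtain ⟨x, hx⟩ := hK.2.nonempty
  have : Nonempty (Fin d) := ⟨⟨0, hd⟩⟩
  rcases (Metric.diam_nonneg (s := K)).eq_or_lt' with h | h
  · obtain ⟨r, hr, hrK⟩ := Metric.isOpen_iff.1 isOpen_interior x hx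
    obtain ⟨v, hv⟩ := NormedSpace.exists_lt_norm ℝ (E d) 0
    set y := x + (r / 2 / ‖v‖) • v with hy
    have hyd : dist y x = r / 2 := by
      rw [dist_eq_norm, hy, add_sub_cancel_left, norm_smul, Real.norm_of_nonneg (by positivity)]
      field_simp
    have hyK : y ∈ K := interior_subset (hrK (by rw [Metric.mem_ball, hyd]; linarith))
    have := Metric.dist_le_diam_of_mem hK.isCompact.isBounded hyK (interior_subset hx)
    linarith
  · exact h

/-- The boundary of a bounded set with nonempty interior has positive surface measure. -/
lemma surf_ne_zero (hd : 1 ≤ d) {K : Set (E d)} (hb : Bornology.IsBounded K)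
    (hi : (interior K).Nonempty) : surf K ≠ 0 := by
  obtain ⟨m, rfl⟩ : ∃ m, d = m + 1 := ⟨d - 1, by omega⟩
  intro h0
  have hfr : (μHE[m] : Measure (E (m + 1))) (frontier K) = 0 := by
    simpa [surf] using h0
  let π : E (m + 1) → E m := fun x => WithLp.toLp 2 fun i => x i.succ
  have hπ : LipschitzWith 1 π := by
    refine LipschitzWith.of_dist_le_mul fun x y => ?_
    rw [NNReal.coe_one, one_mul, EuclideanSpace.dist_eq, EuclideanSpace.dist_eq]
    refine Real.sqrt_le_sqrt ?_
    rw [Fin.sum_univ_succ]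
    exact le_add_of_nonneg_left (sq_nonneg _)
  obtain ⟨x, hx⟩ := hi
  obtain ⟨r, hr, hrK⟩ := Metric.isOpen_iff.1 isOpen_interior x hx
  -- The line over `z` in the dropped direction meets `K` near `x` and leaves the bounded set `K`,
  -- so it crosses the frontier. As `π` is 1-Lipschitz, the frontier has at least the measure of
  -- this ball.
  have hsub : Metric.ball (π x) r ⊆ π '' frontier K := by
    intro z hz
    let g : ℝ → E (m + 1) := fun t => WithLp.toLp 2 (Fin.cons t fun i => z i)
    have hg : Continuous g := by
      refine (PiLp.continuous_toLp 2 _).comp (continuous_pi fun i => ?_)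
      refine Fin.cases ?_ (fun j => ?_) i
      · simpa using continuous_id'
      · simpa using continuous_const
    have hgx : g (x 0) ∈ K := by
      refine interior_subset (hrK ?_)
      rw [Metric.mem_ball] at hz ⊢
      refine lt_of_le_of_lt (le_of_eq ?_) hz
      rw [EuclideanSpace.dist_eq, EuclideanSpace.dist_eq, Fin.sum_univ_succ]
      simp [g, π]
    have hne : g ⁻¹' K ≠ Set.univ := by
      intro hu
      obtain ⟨R, hR⟩ := hb.exists_norm_le
      have h1 := hR (g (R + 1)) (show R + 1 ∈ g ⁻¹' K by rw [hu]; trivial)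
      have h2 := PiLp.norm_apply_le (g (R + 1)) 0
      have h3 : R + 1 ≤ ‖g (R + 1) 0‖ := by simpa [g] using le_abs_self (R + 1)
      linarith
    obtain ⟨t, ht⟩ := nonempty_frontier_iff.2 ⟨⟨x 0, hgx⟩, hne⟩
    refine ⟨g t, hg.frontier_preimage_subset K ht, ?_⟩
    ext i
    simp [π, g]
  have hle : (μHE[m] : Measure (E m)) (π '' frontier K) ≤ 0 := by
    rw [← hfr]
    simp only [Measure.euclideanHausdorffMeasure_def, Measure.smul_apply]
    gcongr
    simpa using hπ.hausdorffMeasure_image_le (d := m) (by positivity) (frontier K)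
  rw [EuclideanSpace.euclideanHausdorffMeasure_eq_volume] at hle
  exact (Metric.measure_ball_pos volume (π x) hr).ne'
    (le_antisymm ((measure_mono hsub).trans hle) bot_le)

/-! ### Constants and averages -/

lemma HasWeakGradient.ae_eq_const {K : Set (E d)} (hK : IsPolyhedralElement K) {w : L2 K}
    (hw : HasWeakGradient K w 0) : ∃ κ : ℝ, ∀ᵐ x ∂(volume.restrict K), w x = κ := by
  have hKm := hK.isCompact.measurableSet
  have : IsFiniteMeasure (volume.restrict K) :=
    isFiniteMeasure_restrict.2 hK.isCompact.measure_lt_top.ne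
  have hint : Integrable (K.indicator w) volume :=
    (integrable_indicator_iff hKm).2 ((Lp.memLp w).integrable (by norm_num))
  obtain ⟨κ, hκ⟩ := ae_eq_const_of_weak_fderiv_eq_zero hint.locallyIntegrable
    isOpen_interior hK.2.isPreconnected (fun φ h1 h2 h3 e => by
      have h4 : ∫ x in K, inner ℝ ((0 : L2Vec K) x) e * φ x = 0 := by
        refine integral_eq_zero_of_ae ?_
        filter_upwards [Lp.coeFn_zero (E d) 2 (volume.restrict K)] with x hx
        rw [hx, Pi.zero_apply, inner_zero_left, zero_mul, Pi.zero_apply]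
      have h5 := hw φ h1 h2 h3 e
      rw [h4, neg_zero, ← integral_indicator hKm] at h5
      rw [← h5]
      congr 1 with x
      by_cases hx : x ∈ K <;> simp [hx])
  refine ⟨κ, ?_⟩
  filter_upwards [hK.ae_mem_interior, ae_restrict_of_ae hκ] with x hx h
  simpa [interior_subset hx] using h hx

/-- For constant `w` the average over `K ∩ B(x, r)` is `|κ - g x|` for every `r > 0`; since it tends
to 0, it is 0. -/
lemma HasTrace.ae_eq_const {K : Set (E d)} (hK : IsPolyhedralElement K) {w : L2 K} {g : L2Bd K}
    (h : HasTrace K w g) {κ : ℝ} (hw : ∀ᵐ x ∂(volume.restrict K), w x = κ) :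
    ∀ᵐ x ∂(surf K), g x = κ := by
  have hmem : ∀ᵐ x ∂(surf K), x ∈ K := by
    have := ae_restrict_mem (μ := (μHE[d - 1] : Measure (E d)))
      (isClosed_frontier (s := K)).measurableSet
    filter_upwards [this] with x hx
    exact hK.isCompact.isClosed.frontier_subset hx
  filter_upwards [h, hmem] with x hx hxK
  have hev : ∀ᶠ r : ℝ in 𝓝[>] 0,
      (⨍ y in Metric.closedBall x r, |w y - g x| ∂(volume.restrict K)) = |κ - g x| := by
    filter_upwards [self_mem_nhdsWithin] with r hr
    have hfin : (volume.restrict K) (Metric.closedBall x r) ≠ ⊤ :=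
      ((Measure.restrict_apply_le _ _).trans_lt
        (isCompact_closedBall x r).measure_lt_top).ne
    rw [← setAverage_const (hK.restrict_closedBall_ne_zero hxK hr) hfin (|κ - g x|)]
    refine average_congr ?_
    filter_upwards [ae_restrict_of_ae hw] with y hy
    rw [hy]
  have := tendsto_nhds_unique (tendsto_const_nhds.congr' (hev.mono fun _ h => h.symm)) hx
  linarith [abs_eq_zero.1 this]

/-- Finiteness of the measure is not needed: an `L²` function that is almost everywhere constant
forces the constant to be 0 or the measure to be finite, and the formula holds in both cases. -/
lemma average_eq_of_ae_eq_const {α : Type*} [MeasurableSpace α] {μ : Measure α} (hμ : μ ≠ 0)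
    (g : Lp ℝ 2 μ) {κ : ℝ} (h : ∀ᵐ x ∂μ, g x = κ) : ⨍ x, g x ∂μ = κ := by
  have hg : MemLp (fun _ : α => κ) 2 μ := (Lp.memLp g).ae_eq h
  rw [average_congr (g := fun _ => κ) h]
  rcases (memLp_const_iff two_ne_zero ENNReal.ofNat_ne_top).1 hg with rfl | hfin
  · simp [average_eq]
  · have : IsFiniteMeasure μ := ⟨hfin⟩
    have : NeZero μ := ⟨hμ⟩
    exact average_const μ κ

/-- The average as a linear functional on `L²`; it vanishes if the measure is infinite. -/
lemma exists_linearMap_average {α : Type*} [MeasurableSpace α] (μ : Measure α) :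
    ∃ A : Lp ℝ 2 μ →ₗ[ℝ] ℝ, (∀ g, A g = ⨍ x, g x ∂μ) ∧ (μ Set.univ = ⊤ → A = 0) := by
  by_cases hμ : μ Set.univ = ⊤
  · refine ⟨0, fun g => ?_, fun _ => rfl⟩
    -- Infinite total mass has real value 0, so the average takes the default value 0.
    simp [average_eq, measureReal_def, hμ]
  · have hfin : IsFiniteMeasure μ := ⟨lt_top_iff_ne_top.2 hμ⟩
    have hint (g : Lp ℝ 2 μ) : Integrable g μ := (Lp.memLp g).integrable (by norm_num)
    refine ⟨{ toFun := fun g => ⨍ x, g x ∂μ, map_add' := fun f g => ?_,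
              map_smul' := fun a g => ?_ }, fun g => rfl, fun h => (hμ h).elim⟩
    · rw [average_congr (Lp.coeFn_add f g)]
      simp only [average_eq, Pi.add_apply]
      rw [integral_add (hint f) (hint g), smul_add]
    · rw [average_congr (Lp.coeFn_smul a g)]
      simp only [average_eq, Pi.smul_apply, integral_const_mul, RingHom.id_apply, smul_eq_mul]
      ring

/-- The constant function `A m` as a linear map into `L²`, where the functional `A` vanishes
unless the measure admits constants. -/
lemma exists_linearMap_const {α X : Type*} [MeasurableSpace α] [AddCommGroup X] [Module ℝ X]
    (μ : Measure α) (A : X →ₗ[ℝ] ℝ) (hA : μ Set.univ = ⊤ → A = 0) :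
    ∃ B : X →ₗ[ℝ] Lp ℝ 2 μ, ∀ m, ∀ᵐ x ∂μ, B m x = A m := by
  by_cases hμ : μ Set.univ = ⊤
  · refine ⟨0, fun m => ?_⟩
    filter_upwards [Lp.coeFn_zero ℝ 2 μ] with x hx
    rw [hA hμ, LinearMap.zero_apply, LinearMap.zero_apply, hx, Pi.zero_apply]
  · have hfin : IsFiniteMeasure μ := ⟨lt_top_iff_ne_top.2 hμ⟩
    exact ⟨Lp.constₗ 2 μ ℝ ∘ₗ A, fun m => Lp.coeFn_const 2 μ (A m)⟩

lemma integral_sub_sq_eq_norm_sq {α : Type*} [MeasurableSpace α] {μ : Measure α} {f g : Lp ℝ 2 μ}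
    {a : ℝ} (h : ∀ᵐ x ∂μ, g x = a) : ∫ x, (f x - a) ^ 2 ∂μ = ‖f - g‖ ^ 2 := by
  rw [← real_inner_self_eq_norm_sq, L2.inner_def]
  refine integral_congr_ae ?_
  filter_upwards [h, Lp.coeFn_sub f g] with x hx hs
  rw [hs, Pi.sub_apply, hx, real_inner_self_eq_norm_sq, Real.norm_eq_abs, sq_abs]

/-! ### The tensor -/

/-- In finite dimension the supremum of the Rayleigh quotient is itself an eigenvalue, and the
spectrum is bounded. -/
lemma inner_toEuclideanLin_le_sSup_spectrum [Nontrivial (E d)] {A : Matrix (Fin d) (Fin d) ℝ}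
    (hA : A.IsSymm) (ξ : E d) :
    inner ℝ (Matrix.toEuclideanLin A ξ) ξ ≤ sSup (spectrum ℝ A) * ‖ξ‖ ^ 2 := by
  have hs : (Matrix.toEuclideanLin A).IsSymmetric :=
    Matrix.isSymmetric_toEuclideanLin_iff.2
      (by rwa [Matrix.IsHermitian, Matrix.conjTranspose_eq_transpose_of_trivial])
  rcases eq_or_ne ξ 0 with rfl | hξ
  · simp
  have hev := hs.hasEigenvalue_iSup_of_finiteDimensional.mem_spectrum
  rw [Matrix.toEuclideanLin, Matrix.spectrum_toLpLin] at hev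
  have hfin : BddAbove (spectrum ℝ A) := A.finite_real_spectrum.bddAbove
  have hle := le_csSup hfin hev
  rw [← div_le_iff₀ (by positivity)]
  refine le_trans ?_ hle
  let L := (Matrix.toEuclideanLin A).toContinuousLinearMap
  refine le_ciSup (f := fun x : { x : E d // x ≠ 0 } =>
    RCLike.re (inner ℝ (Matrix.toEuclideanLin A x) (x : E d)) / ‖(x : E d)‖ ^ 2) ?_ ⟨ξ, hξ⟩
  refine ⟨‖L‖, ?_⟩
  rintro _ ⟨⟨x, hx⟩, rfl⟩
  have hx' : 0 < ‖x‖ := norm_pos_iff.2 hx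
  simp only [RCLike.re_to_real]
  rw [div_le_iff₀ (by positivity), pow_two, ← mul_assoc]
  exact (real_inner_le_norm _ _).trans (by gcongr; exact L.le_opNorm x)

/-- Guarantees that the essential supremum behind `lambdaMax` is finite; otherwise `toReal` would
turn it into 0. -/
lemma abs_sSup_spectrum_le [Nontrivial (E d)] {A : Matrix (Fin d) (Fin d) ℝ} (hA : A.IsSymm)
    {β : ℝ} (h0 : ∀ ξ : E d, 0 ≤ inner ℝ (Matrix.toEuclideanLin A ξ) ξ)
    (hβ : ∀ ξ : E d, inner ℝ (Matrix.toEuclideanLin A ξ) ξ ≤ β * ‖ξ‖ ^ 2) :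
    |sSup (spectrum ℝ A)| ≤ β := by
  obtain ⟨ξ, hξ⟩ := exists_ne (0 : E d)
  have hξ' : 0 < ‖ξ‖ := norm_pos_iff.2 hξ
  have h1 := inner_toEuclideanLin_le_sSup_spectrum hA ξ
  have hβ0 : 0 ≤ β := nonneg_of_mul_nonneg_left ((h0 ξ).trans (hβ ξ)) (by positivity)
  rw [abs_of_nonneg (nonneg_of_mul_nonneg_left ((h0 ξ).trans h1) (by positivity))]
  refine Real.sSup_le (fun μ hμ => ?_) hβ0
  rw [← Matrix.spectrum_toLpLin (p := 2)] at hμ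
  obtain ⟨x, hx⟩ := (Module.End.HasEigenvalue.of_mem_spectrum hμ).exists_hasEigenvector
  have hx' : 0 < ‖x‖ := norm_pos_iff.2 hx.2
  have h2 := hβ x
  rw [Matrix.toEuclideanLin, hx.apply_eq_smul, real_inner_smul_left,
    real_inner_self_eq_norm_sq] at h2
  exact le_of_mul_le_mul_right h2 (by positivity)

/-- Cauchy–Schwarz for a semidefinite form, from the discriminant of the nonnegative quadratic `t ↦
(A(ξ + tη), ξ + tη)`. -/
lemma inner_toEuclideanLin_sq_le {A : Matrix (Fin d) (Fin d) ℝ} (hA : A.IsSymm)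
    (h0 : ∀ ξ : E d, 0 ≤ inner ℝ (Matrix.toEuclideanLin A ξ) ξ) (ξ η : E d) :
    inner ℝ (Matrix.toEuclideanLin A ξ) η ^ 2
      ≤ inner ℝ (Matrix.toEuclideanLin A ξ) ξ * inner ℝ (Matrix.toEuclideanLin A η) η := by
  have hs : (Matrix.toEuclideanLin A).IsSymmetric :=
    Matrix.isSymmetric_toEuclideanLin_iff.2
      (by rwa [Matrix.IsHermitian, Matrix.conjTranspose_eq_transpose_of_trivial])
  have h := discrim_le_zero (a := inner ℝ (Matrix.toEuclideanLin A η) η)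
    (b := 2 * inner ℝ (Matrix.toEuclideanLin A ξ) η)
    (c := inner ℝ (Matrix.toEuclideanLin A ξ) ξ) fun t => by
      have := h0 (ξ + t • η)
      have hsymm : inner ℝ (Matrix.toEuclideanLin A η) ξ
          = inner ℝ (Matrix.toEuclideanLin A ξ) η := by
        rw [hs, real_inner_comm]
      simp only [map_add, map_smul, inner_add_left, inner_add_right, real_inner_smul_left,
        real_inner_smul_right, hsymm] at this
      linarith
  rw [discrim] at h
  linarith

/-- Pointwise Cauchy–Schwarz for `c x` bounds the integrand by `√λ_max · √(c q · q) · |v|`; Hölder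
with exponents 2, 2 finishes. The second part is the dual-norm bound on the residual, the first
makes `Θ_K` nonnegative. -/
lemma cForm_sq_le [Nontrivial (E d)] {K : Set (E d)} {c : E d → Matrix (Fin d) (Fin d) ℝ}
    (hc : IsAdmissibleTensor K c) (q v : L2Vec K) :
    0 ≤ lambdaMax K c * cForm K c q q ∧
    cForm K c q v ^ 2 ≤ lambdaMax K c * cForm K c q q * ‖v‖ ^ 2 := by
  obtain ⟨hmeas, hsymm, α, β, hα, hb⟩ := hc
  have h0 : ∀ᵐ x ∂(volume.restrict K), ∀ ξ : E d,
      0 ≤ inner ℝ (Matrix.toEuclideanLin (c x) ξ) ξ := by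
    filter_upwards [hb] with x hx ξ
    exact le_trans (by positivity) (hx ξ).1
  have hlam : ∀ᵐ x ∂(volume.restrict K), sSup (spectrum ℝ (c x)) ≤ lambdaMax K c := by
    have hfin : eLpNorm (fun x => sSup (spectrum ℝ (c x))) ⊤ (volume.restrict K) ≠ ⊤ := by
      refine ((eLpNorm_le_of_ae_bound (C := β) ?_).trans_lt ?_).ne
      · filter_upwards [hsymm, h0, hb] with x h1 h2 h3
        exact abs_sSup_spectrum_le h1 h2 fun ξ => (h3 ξ).2
      · simp
    rw [eLpNorm_exponent_top] at hfin
    filter_upwards [ae_le_eLpNormEssSup (f := fun x => sSup (spectrum ℝ (c x)))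
      (μ := volume.restrict K)] with x hx
    rw [lambdaMax, eLpNorm_exponent_top]
    have := ENNReal.toReal_mono hfin hx
    rw [toReal_enorm] at this
    exact (le_abs_self _).trans this
  have hlam0 : 0 ≤ lambdaMax K c := ENNReal.toReal_nonneg
  have hq0 : 0 ≤ cForm K c q q := by
    refine integral_nonneg_of_ae ?_
    filter_upwards [h0] with x hx using hx _
  refine ⟨mul_nonneg hlam0 hq0, ?_⟩
  have hcq : AEStronglyMeasurable (fun x => Matrix.toEuclideanLin (c x) (q x))
      (volume.restrict K) := by
    refine AEMeasurable.aestronglyMeasurable ?_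
    have hqm := (Lp.aestronglyMeasurable q).aemeasurable
    have hqi (i : Fin d) : AEMeasurable (fun x => q x i) (volume.restrict K) :=
      (EuclideanSpace.proj i : E d →L[ℝ] ℝ).continuous.measurable.comp_aemeasurable hqm
    refine (WithLp.measurable_toLp 2 (Fin d → ℝ)).comp_aemeasurable
      (f := fun x i => ∑ j, c x i j * q x j) (aemeasurable_pi_lambda _ fun i => ?_)
    exact Finset.aemeasurable_fun_sum _ fun j _ => (hmeas i j).mul (hqi j)
  set f : E d → ℝ := fun x => √(inner ℝ (Matrix.toEuclideanLin (c x) (q x)) (q x)) with hf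
  have hfm : MemLp f 2 (volume.restrict K) := by
    refine ((Lp.memLp q).norm.const_mul (√β)).mono
      (hcq.inner (Lp.aestronglyMeasurable q)).aemeasurable.sqrt.aestronglyMeasurable ?_
    filter_upwards [h0, hb] with x h1 h2
    rw [Real.norm_of_nonneg (Real.sqrt_nonneg _)]
    refine le_trans (Real.sqrt_le_sqrt (h2 (q x)).2) (le_trans (le_of_eq ?_) (le_abs_self _))
    rw [Real.sqrt_mul' _ (by positivity), Real.sqrt_sq (norm_nonneg _)]
  have hvm : MemLp (fun x => ‖v x‖) 2 (volume.restrict K) := (Lp.memLp v).norm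
  have hpt : ∀ᵐ x ∂(volume.restrict K), ‖inner ℝ (Matrix.toEuclideanLin (c x) (q x)) (v x)‖
      ≤ √(lambdaMax K c) * (f x * ‖v x‖) := by
    filter_upwards [hsymm, h0, hlam] with x h1 h2 h3
    have h4 := inner_toEuclideanLin_sq_le h1 h2 (q x) (v x)
    have h5 : inner ℝ (Matrix.toEuclideanLin (c x) (v x)) (v x) ≤ lambdaMax K c * ‖v x‖ ^ 2 :=
      (inner_toEuclideanLin_le_sSup_spectrum h1 _).trans (by gcongr)
    refine abs_le_of_sq_le_sq (h4.trans ?_) (by positivity)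
    rw [mul_pow, mul_pow, Real.sq_sqrt hlam0, hf, Real.sq_sqrt (h2 _)]
    calc _ ≤ _ := mul_le_mul_of_nonneg_left h5 (h2 _)
      _ = _ := by ring
  have hle : |cForm K c q v| ≤ √(lambdaMax K c) * ∫ x in K, f x * ‖v x‖ := by
    rw [← integral_const_mul]
    exact norm_integral_le_of_norm_le ((hfm.integrable_mul hvm).const_mul _) hpt
  have hH := integral_mul_le_Lp_mul_Lq_of_nonneg (μ := volume.restrict K)
    (Real.HolderConjugate.two_two) (f := f) (g := fun x => ‖v x‖)
    (Eventually.of_forall fun x => Real.sqrt_nonneg _)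
    (Eventually.of_forall fun x => norm_nonneg _) (by simpa using hfm) (by simpa using hvm)
  have e1 : ∫ x in K, f x ^ (2 : ℝ) = cForm K c q q := by
    refine integral_congr_ae ?_
    filter_upwards [h0] with x hx
    rw [Real.rpow_two, hf, Real.sq_sqrt (hx _)]
  have e2 : ∫ x in K, ‖v x‖ ^ (2 : ℝ) = ‖v‖ ^ 2 := by
    rw [← real_inner_self_eq_norm_sq, L2.inner_def]
    refine integral_congr_ae (Eventually.of_forall fun x => ?_)
    simp only [Real.rpow_two, real_inner_self_eq_norm_sq]
  rw [e1, e2, ← Real.sqrt_eq_rpow, ← Real.sqrt_eq_rpow, Real.sqrt_sq (norm_nonneg _)] at hH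
  have hfin : |cForm K c q v| ≤ √(lambdaMax K c) * (√(cForm K c q q) * ‖v‖) :=
    hle.trans (by gcongr)
  calc cForm K c q v ^ 2 = |cForm K c q v| ^ 2 := (sq_abs _).symm
    _ ≤ (√(lambdaMax K c) * (√(cForm K c q q) * ‖v‖)) ^ 2 := by gcongr
    _ = _ := by rw [mul_pow, mul_pow, Real.sq_sqrt hlam0, Real.sq_sqrt hq0, mul_assoc]

/-! ### Similarity transformations -/

/-- The similarity transformation as a homeomorphism. -/
def similarityHomeomorph {ρ : ℝ} (hρ : 0 < ρ) (R : E d ≃ₗᵢ[ℝ] E d) (b : E d) : E d ≃ₜ E d :=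
  (R.toHomeomorph.trans (Homeomorph.smulOfNeZero ρ hρ.ne')).trans (Homeomorph.addLeft b)

lemma coe_similarityHomeomorph {ρ : ℝ} (hρ : 0 < ρ) (R : E d ≃ₗᵢ[ℝ] E d) (b : E d) :
    ⇑(similarityHomeomorph hρ R b) = similarity ρ R b := rfl

-- Volume and surface measure are both normalized Hausdorff measures, so this one computation
-- supplies both Jacobians, `ρ^d` and `ρ^(d-1)`.
open scoped Pointwise in
lemma euclideanHausdorffMeasure_similarity_image {ρ : ℝ} (hρ : 0 < ρ) (R : E d ≃ₗᵢ[ℝ] E d)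
    (b : E d) (k : ℕ) (s : Set (E d)) :
    (μHE[k] : Measure (E d)) (similarity ρ R b '' s) = ENNReal.ofReal (ρ ^ k) * μHE[k] s := by
  have h : similarity ρ R b '' s = (b + ·) '' (ρ • (R '' s)) := by
    rw [← Set.image_smul, Set.image_image, Set.image_image]
    rfl
  rw [h, (show Isometry (b + ·) from (IsometryEquiv.addLeft b).isometry).euclideanHausdorffMeasure_image,
   
    Measure.euclideanHausdorffMeasure_smul₀ k hρ.ne', R.isometry.euclideanHausdorffMeasure_image,
    ENNReal.smul_def, smul_eq_mul, ENNReal.coe_pow, ENNReal.ofReal_pow hρ.le, ← enorm_eq_nnnorm,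
    Real.enorm_of_nonneg hρ.le]

lemma euclideanHausdorffMeasure_restrict_similarity_image {ρ : ℝ} (hρ : 0 < ρ)
    (R : E d ≃ₗᵢ[ℝ] E d) (b : E d) (k : ℕ) (s : Set (E d)) :
    (μHE[k] : Measure (E d)).restrict (similarity ρ R b '' s)
      = ENNReal.ofReal (ρ ^ k) • ((μHE[k]).restrict s).map (similarity ρ R b) := by
  have hm : Measurable (similarity ρ R b) := (similarityHomeomorph hρ R b).measurable
  ext t ht
  rw [Measure.restrict_apply ht, Measure.smul_apply, Measure.map_apply hm ht,
    Measure.restrict_apply (hm ht), smul_eq_mul, ← euclideanHausdorffMeasure_similarity_image hρ,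
    Set.image_preimage_inter]

lemma volume_restrict_similarity_image {ρ : ℝ} (hρ : 0 < ρ)
    (R : E d ≃ₗᵢ[ℝ] E d) (b : E d) (s : Set (E d)) :
    (volume : Measure (E d)).restrict (similarity ρ R b '' s)
      = ENNReal.ofReal (ρ ^ d) • (volume.restrict s).map (similarity ρ R b) := by
  rw [← EuclideanSpace.euclideanHausdorffMeasure_eq_volume]
  exact euclideanHausdorffMeasure_restrict_similarity_image hρ R b d s

lemma surf_similarity_image {ρ : ℝ} (hρ : 0 < ρ)
    (R : E d ≃ₗᵢ[ℝ] E d) (b : E d) (K : Set (E d)) :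
    surf (similarity ρ R b '' K)
      = ENNReal.ofReal (ρ ^ (d - 1)) • (surf K).map (similarity ρ R b) := by
  rw [surf, surf, ← euclideanHausdorffMeasure_restrict_similarity_image hρ,
    ← coe_similarityHomeomorph hρ, Homeomorph.image_frontier]

lemma diam_similarity_image {ρ : ℝ} (hρ : 0 < ρ) (R : E d ≃ₗᵢ[ℝ] E d) (b : E d) (K : Set (E d)) :
    Metric.diam (similarity ρ R b '' K) = ρ * Metric.diam K := by
  have h : similarity ρ R b '' K = (b + ·) '' ((ρ • ·) '' (R '' K)) := by
    rw [Set.image_image, Set.image_image]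
    rfl
  rw [h, (show Isometry (b + ·) from (IsometryEquiv.addLeft b).isometry).diam_image, Set.image_smul,
    diam_smul₀, R.isometry.diam_image, Real.norm_of_nonneg hρ.le]

lemma integral_smul_map {α : Type*} [MeasurableSpace α] {μ μ' : Measure α} {Φ : α → α}
    (hΦ : MeasurableEmbedding Φ) {s : ℝ} (hs : 0 ≤ s) (hμ : μ' = ENNReal.ofReal s • μ.map Φ)
    (f : α → ℝ) : ∫ y, f y ∂μ' = s * ∫ x, f (Φ x) ∂μ := by
  rw [hμ, integral_smul_measure, hΦ.integral_map, ENNReal.toReal_ofReal hs, smul_eq_mul]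

/-- Change of variables in `L²` inner products. -/
lemma inner_of_ae_comp {F : Type*} [NormedAddCommGroup F] [InnerProductSpace ℝ F]
    {μ μ' : Measure (E d)} {Φ : E d → E d} (hΦ : MeasurableEmbedding Φ) {s : ℝ} (hs : 0 ≤ s)
    (hμ : μ' = ENNReal.ofReal s • μ.map Φ) (J : F →ₗᵢ[ℝ] F) (a b : ℝ) {f g : Lp F 2 μ}
    {f' g' : Lp F 2 μ'} (hf : ∀ᵐ x ∂μ, f' (Φ x) = a • J (f x))
    (hg : ∀ᵐ x ∂μ, g' (Φ x) = b • J (g x)) :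
    inner ℝ f' g' = s * (a * b) * inner ℝ f g := by
  rw [L2.inner_def, L2.inner_def, mul_assoc, ← integral_const_mul]
  rw [integral_smul_map hΦ hs hμ]
  congr 1
  refine integral_congr_ae ?_
  filter_upwards [hf, hg] with x h1 h2
  rw [h1, h2, real_inner_smul_left, real_inner_smul_right, J.inner_map_map, mul_assoc]

/-! ### Estimates on the reference element -/

lemma green {K : Set (E d)} (v : Hdiv K) (w : H1 K) :
    inner ℝ (H1.grad w) (Hdiv.val v) + inner ℝ (H1.val w) (Hdiv.div v)
      = inner ℝ (H1.trace w) (Hdiv.ntrace v) := by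
  have h1 : inner ℝ (H1.grad w) (Hdiv.val v) = inner ℝ (Hdiv.val v) (H1.grad w) :=
    real_inner_comm _ _
  have h2 : inner ℝ (H1.val w) (Hdiv.div v) = inner ℝ (Hdiv.div v) (H1.val w) :=
    real_inner_comm _ _
  have h3 : inner ℝ (H1.trace w) (Hdiv.ntrace v) = inner ℝ (Hdiv.ntrace v) (H1.trace w) :=
    real_inner_comm _ _
  exact (congrArg₂ (· + ·) h1 h2).trans (Eq.trans (v.2 w) h3.symm)

set_option maxHeartbeats 1000000 in
/-- The residual of the constitutive relation and the stabilization seminorm determine `∇u` and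
`u - û`. -/
lemma IsMDecomposition.grad_eq_zero_and_trace_eq {S : LocalSpaces d}
    {Vt : Submodule ℝ (Hdiv S.K)} {Wt : Submodule ℝ (H1 S.K)} (hM : IsMDecomposition S Vt Wt)
    (hS : IsStabilizationSubspace S Wt) {u : H1 S.K} (hu : u ∈ S.W) {uhat : L2Bd S.K}
    (huhat : uhat ∈ S.M)
    (hF : ∀ v ∈ S.V, inner ℝ (H1.val u) (Hdiv.div v) - inner ℝ uhat (Hdiv.ntrace v) = 0)
    (hP : S.MS.starProjection (H1.trace u - uhat) = 0) :
    H1.grad u = 0 ∧ H1.trace u = uhat := by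
  have hF' (v : Hdiv S.K) (hv : v ∈ S.V) :
      inner ℝ (H1.trace u - uhat) (Hdiv.ntrace v) = inner ℝ (H1.grad u) (Hdiv.val v) := by
    rw [inner_sub_left]
    linarith [hF v hv, green v u]
  have hm : H1.trace u - uhat ∈ S.M := by
    have := hM.tr_mem 0 S.V.zero_mem u hu
    rw [tr, map_zero, zero_add] at this
    exact S.M.sub_mem this huhat
  obtain ⟨⟨v, w⟩, ⟨hv, hw⟩, hvw⟩ := hM.tr_bij.surjOn hm
  have hperp {x : H1 S.K} (hx : x ∈ S.W) : inner ℝ (H1.grad x) (Hdiv.val v) = 0 :=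
    (Submodule.mem_orthogonal _ _).1 hv.2 _ (hM.grad_mem ⟨x, hx, rfl⟩)
  have h1 : inner ℝ (H1.val w) (Hdiv.div v) = 0 := by
    rw [real_inner_comm]
    exact (Submodule.mem_orthogonal _ _).1 hw.2 _ (hM.div_mem ⟨v, hv.1, rfl⟩)
  have h2 : inner ℝ (H1.trace w) (Hdiv.ntrace v) = 0 := by
    rw [← green v w, hperp hw.1, h1, add_zero]
  -- Testing with `v` itself: the right side vanishes because `∇u ∈ Ṽ`, and the left side is
  -- `‖v·n‖²` because `w` is orthogonal to `v·n`.
  have h3 : Hdiv.ntrace v = 0 := by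
    have h4 := hF' v hv.1
    rw [hperp hu, ← hvw, tr, inner_add_left, h2, add_zero] at h4
    exact inner_self_eq_zero.1 h4
  rw [tr, h3, zero_add] at hvw
  have hw0 : w = 0 := hS.isNorm w hw (by rw [hvw, hP, norm_zero])
  rw [hw0, map_zero] at hvw
  refine ⟨?_, (sub_eq_zero.1 hvw.symm)⟩
  obtain ⟨v', hv', hgv⟩ := hM.grad_mem ⟨u, hu, rfl⟩
  have h5 := hF' v' (hM.le_V hv')
  rw [← hvw, inner_zero_left, hgv] at h5
  exact inner_self_eq_zero.1 h5.symm

lemma ae_eq_const_of_grad_eq_zero {K : Set (E d)} (hK : IsPolyhedralElement K) {u : H1 K}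
    (hu : H1.grad u = 0) : ∃ κ : ℝ, (∀ᵐ x ∂(volume.restrict K), H1.val u x = κ) ∧
      ∀ᵐ x ∂(surf K), H1.trace u x = κ := by
  have h : HasWeakGradient K (H1.val u) (H1.grad u) := u.2.1
  rw [hu] at h
  obtain ⟨κ, hκ⟩ := h.ae_eq_const hK
  exact ⟨κ, hκ, HasTrace.ae_eq_const hK (u.2.2 : HasTrace K (H1.val u) (H1.trace u)) hκ⟩

/-- Estimates for a saddle-point type relation on finite-dimensional spaces: a pair `(u, m)` is
controlled by the dual norm of the residual `v ↦ (val u, div v) - ⟨m, ntr v⟩` and by `P (tr u - m)`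
as soon as these determine it. -/
lemma exists_sq_norm_le_of_residual {X Y H G B : Type*} [AddCommGroup X] [Module ℝ X]
    [AddCommGroup Y] [Module ℝ Y] [NormedAddCommGroup H] [InnerProductSpace ℝ H]
    [NormedAddCommGroup G] [InnerProductSpace ℝ G] [NormedAddCommGroup B] [InnerProductSpace ℝ B]
    (val : X →ₗ[ℝ] H) (grad : X →ₗ[ℝ] G) (tr : X →ₗ[ℝ] B) (vec : Y →ₗ[ℝ] G) (div : Y →ₗ[ℝ] H)
    (ntr : Y →ₗ[ℝ] B) (W : Submodule ℝ X) (V : Submodule ℝ Y) (M : Submodule ℝ B)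
    [FiniteDimensional ℝ W] [FiniteDimensional ℝ V] [FiniteDimensional ℝ M] (P : B →ₗ[ℝ] B)
    (D : B →ₗ[ℝ] H) (A : B →ₗ[ℝ] B)
    (hker : ∀ u ∈ W, ∀ m ∈ M, (∀ v ∈ V, inner ℝ (val u) (div v) - inner ℝ m (ntr v) = 0) →
      P (tr u - m) = 0 → grad u = 0 ∧ tr u = m ∧ val u = D m ∧ m = A m) :
    ∃ C : ℝ, 0 ≤ C ∧ ∀ u ∈ W, ∀ m ∈ M, ∀ a : ℝ, 0 ≤ a →
      (∀ v ∈ V, (inner ℝ (val u) (div v) - inner ℝ m (ntr v)) ^ 2 ≤ a * ‖vec v‖ ^ 2) →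
      ‖grad u‖ ^ 2 ≤ C * (a + ‖P (tr u - m)‖ ^ 2) ∧
      ‖tr u - m‖ ^ 2 ≤ C * (a + ‖P (tr u - m)‖ ^ 2) ∧
      ‖val u - D m‖ ^ 2 ≤ C * (a + ‖P (tr u - m)‖ ^ 2) ∧
      ‖m - A m‖ ^ 2 ≤ C * (a + ‖P (tr u - m)‖ ^ 2) := by
  let U : W × M →ₗ[ℝ] X := W.subtype ∘ₗ LinearMap.fst ℝ _ _
  let E : W × M →ₗ[ℝ] B := M.subtype ∘ₗ LinearMap.snd ℝ _ _
  let b := Module.finBasis ℝ V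
  let ℓ (v : Y) : W × M →ₗ[ℝ] ℝ :=
    (innerSL ℝ (div v)).toLinearMap ∘ₗ val ∘ₗ U - (innerSL ℝ (ntr v)).toLinearMap ∘ₗ E
  let J : W × M →ₗ[ℝ] B := tr ∘ₗ U - E
  have hℓ (v : Y) (x : W × M) :
      ℓ v x = inner ℝ (val x.1) (div v) - inner ℝ (x.2 : B) (ntr v) := by
    rw [real_inner_comm, real_inner_comm (ntr v)]
    rfl
  -- `T` collects the data, the residual being tested on a basis of `V` only; `N` collects the four
  -- quantities to be bounded. The averages enter through the linear maps `D` and `A`, which keeps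
  -- `N` linear.
  let T := (LinearMap.pi fun i => ℓ (b i)).prod (P ∘ₗ J)
  let N := (grad ∘ₗ U).prod (J.prod ((val ∘ₗ U - D ∘ₗ E).prod (E - A ∘ₗ E)))
  have hTN : T.ker ≤ N.ker := by
    rintro ⟨⟨u, hu⟩, ⟨m, hm⟩⟩ hx
    have hx1 : ∀ i, ℓ (b i) (⟨u, hu⟩, ⟨m, hm⟩) = 0 := fun i =>
      congrFun (congrArg Prod.fst (LinearMap.mem_ker.1 hx)) i
    have hx2 : P (tr u - m) = 0 := congrArg Prod.snd (LinearMap.mem_ker.1 hx)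
    let L : V →ₗ[ℝ] ℝ := ((innerSL ℝ (val u)).toLinearMap ∘ₗ div
      - (innerSL ℝ m).toLinearMap ∘ₗ ntr) ∘ₗ V.subtype
    have hL : L = 0 := b.ext fun i => (hℓ (b i) (⟨u, hu⟩, ⟨m, hm⟩)).symm.trans (hx1 i)
    obtain ⟨h1, h2, h3, h4⟩ := hker u hu m hm (fun v hv => LinearMap.congr_fun hL ⟨v, hv⟩) hx2
    exact LinearMap.mem_ker.2 (Prod.ext h1 (Prod.ext (sub_eq_zero.2 h2)
      (Prod.ext (sub_eq_zero.2 h3) (sub_eq_zero.2 h4))))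
  obtain ⟨C, hC, hNT⟩ := exists_norm_le_mul_norm_of_ker_le T N hTN
  set S : ℝ := ∑ i, ‖vec (b i)‖ ^ 2
  have hS : 0 ≤ S := by positivity
  -- `S` converts the dual-norm bound into a bound on each basis residual; the added 1 pays for the
  -- projection term. Products carry the sup norm, so components are bounded separately.
  refine ⟨C ^ 2 * (S + 1), by positivity, fun u hu m hm a ha hres => ?_⟩
  set p := ‖P (tr u - m)‖ with hp
  set x : W × M := (⟨u, hu⟩, ⟨m, hm⟩) with hx
  have hT : ‖T x‖ ^ 2 ≤ (S + 1) * (a + p ^ 2) := by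
    have h1 : ‖T x‖ ≤ √(S * a + p ^ 2) := by
      refine norm_prod_le_iff.2 ⟨(pi_norm_le_iff_of_nonneg (Real.sqrt_nonneg _)).2 fun i => ?_, ?_⟩
      · refine Real.abs_le_sqrt ?_
        have h2 : (T x).1 i = ℓ (b i) x := rfl
        rw [h2, hℓ]
        have h3 : ‖vec (b i)‖ ^ 2 ≤ S :=
          Finset.single_le_sum (f := fun i => ‖vec (b i)‖ ^ 2)
            (fun i _ => sq_nonneg _) (Finset.mem_univ i)
        have h4 := mul_le_mul_of_nonneg_left h3 ha
        linarith [hres (b i) (b i).2, sq_nonneg p]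
      · refine Real.le_sqrt_of_sq_le ?_
        have h2 : ‖(T x).2‖ = p := rfl
        rw [h2]
        linarith [mul_nonneg hS ha]
    calc ‖T x‖ ^ 2 ≤ √(S * a + p ^ 2) ^ 2 := by gcongr
      _ = S * a + p ^ 2 := Real.sq_sqrt (by positivity)
      _ ≤ (S + 1) * (a + p ^ 2) := by nlinarith [mul_nonneg hS (sq_nonneg p)]
  have hN : ‖N x‖ ^ 2 ≤ C ^ 2 * (S + 1) * (a + p ^ 2) := by
    calc ‖N x‖ ^ 2 ≤ (C * ‖T x‖) ^ 2 := by gcongr; exact hNT x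
      _ = C ^ 2 * ‖T x‖ ^ 2 := mul_pow _ _ _
      _ ≤ C ^ 2 * ((S + 1) * (a + p ^ 2)) := by gcongr
      _ = _ := (mul_assoc _ _ _).symm
  have hcomp {r : ℝ} (h0 : 0 ≤ r) (h : r ≤ ‖N x‖) : r ^ 2 ≤ C ^ 2 * (S + 1) * (a + p ^ 2) :=
    (pow_le_pow_left₀ h0 h 2).trans hN
  have n1 : ‖(N x).2‖ ≤ ‖N x‖ := norm_snd_le _
  have n2 : ‖(N x).2.2‖ ≤ ‖N x‖ := (norm_snd_le _).trans n1
  exact ⟨hcomp (norm_nonneg _) (norm_fst_le (N x)),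
    hcomp (norm_nonneg _) ((norm_fst_le (N x).2).trans n1),
    hcomp (norm_nonneg _) ((norm_fst_le (N x).2.2).trans n2),
    hcomp (norm_nonneg _) ((norm_snd_le (N x).2.2).trans n2)⟩

set_option maxHeartbeats 2000000 in
/-- The estimates on a fixed element, for residuals bounded in the dual norm. -/
lemma exists_reference_bound (hd : 1 ≤ d) {S : LocalSpaces d} (hK : IsPolyhedralElement S.K)
    {Vt : Submodule ℝ (Hdiv S.K)} {Wt : Submodule ℝ (H1 S.K)} (hM : IsMDecomposition S Vt Wt)
    (hS : IsStabilizationSubspace S Wt) :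
    ∃ C : ℝ, 0 ≤ C ∧ ∀ u ∈ S.W, ∀ uhat ∈ S.M, ∀ a : ℝ, 0 ≤ a →
      (∀ v ∈ S.V, (inner ℝ (H1.val u) (Hdiv.div v) - inner ℝ uhat (Hdiv.ntrace v)) ^ 2
        ≤ a * ‖Hdiv.val v‖ ^ 2) →
      ‖H1.grad u‖ ^ 2 ≤ C * (a + ‖S.MS.starProjection (H1.trace u - uhat)‖ ^ 2) ∧
      ‖H1.trace u - uhat‖ ^ 2 ≤ C * (a + ‖S.MS.starProjection (H1.trace u - uhat)‖ ^ 2) ∧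
      ∫ x in S.K, (H1.val u x - ⨍ y, uhat y ∂(surf S.K)) ^ 2
        ≤ C * (a + ‖S.MS.starProjection (H1.trace u - uhat)‖ ^ 2) ∧
      ∫ x, (uhat x - ⨍ y, uhat y ∂(surf S.K)) ^ 2 ∂(surf S.K)
        ≤ C * (a + ‖S.MS.starProjection (H1.trace u - uhat)‖ ^ 2) := by
  have hsurf := surf_ne_zero hd hK.isCompact.isBounded hK.2.nonempty
  obtain ⟨A, hA, hAtop⟩ := exists_linearMap_average (surf S.K)
  obtain ⟨B, hB⟩ := exists_linearMap_const (surf S.K) A hAtop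
  obtain ⟨D, hD⟩ := exists_linearMap_const (volume.restrict S.K) A fun h => by
    rw [Measure.restrict_apply_univ] at h
    exact (hK.isCompact.measure_lt_top.ne h).elim
  obtain ⟨C, hC, hbound⟩ := exists_sq_norm_le_of_residual H1.val H1.grad H1.trace Hdiv.val Hdiv.div
    Hdiv.ntrace S.W S.V S.M S.MS.starProjection.toLinearMap D B fun u hu uhat huhat hF hP => by
      obtain ⟨hg, ht⟩ := hM.grad_eq_zero_and_trace_eq hS hu huhat hF hP
      obtain ⟨κ, hκ1, hκ2⟩ := ae_eq_const_of_grad_eq_zero hK hg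
      rw [ht] at hκ2
      have hAκ : A uhat = κ := (hA uhat).trans (average_eq_of_ae_eq_const hsurf uhat hκ2)
      have hDu : H1.val u = D uhat := by
        refine Lp.ext ?_
        filter_upwards [hκ1, hD uhat] with x h1 h2
        rw [h1, h2, hAκ]
      have hBu : uhat = B uhat := by
        refine Lp.ext ?_
        filter_upwards [hκ2, hB uhat] with x h1 h2
        rw [h1, h2, hAκ]
      exact ⟨hg, ht, hDu, hBu⟩
  refine ⟨C, hC, fun u hu uhat huhat a ha hres => ?_⟩
  obtain ⟨h1, h2, h3, h4⟩ := hbound u hu uhat huhat a ha hres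
  refine ⟨h1, h2, ?_, ?_⟩
  · rw [← hA]
    exact (integral_sub_sq_eq_norm_sq (hD uhat)).trans_le h3
  · rw [← hA]
    exact (integral_sub_sq_eq_norm_sq (hB uhat)).trans_le h4

/-! ### Transport to similar elements -/

lemma average_smul_map {α : Type*} [MeasurableSpace α] {μ μ' : Measure α} {Φ : α → α}
    (hΦ : MeasurableEmbedding Φ) {s : ℝ} (hs : 0 < s) (hμ : μ' = ENNReal.ofReal s • μ.map Φ)
    (f : α → ℝ) : ⨍ y, f y ∂μ' = ⨍ x, f (Φ x) ∂μ := by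
  have huniv : μ'.real Set.univ = s * μ.real Set.univ := by
    rw [hμ, measureReal_def, Measure.smul_apply, Measure.map_apply hΦ.measurable .univ,
      Set.preimage_univ, smul_eq_mul, ENNReal.toReal_mul, ENNReal.toReal_ofReal hs.le,
      measureReal_def]
  rw [average_eq, average_eq, integral_smul_map hΦ hs.le hμ, huniv, smul_eq_mul, smul_eq_mul,
    mul_inv]
  field_simp

section Transport

variable {ρ : ℝ} {R : E d ≃ₗᵢ[ℝ] E d} {b : E d} {S S' : LocalSpaces d}

lemma measurableEmbedding_similarity (hρ : 0 < ρ) (R : E d ≃ₗᵢ[ℝ] E d) (b : E d) :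
    MeasurableEmbedding (similarity ρ R b) :=
  (similarityHomeomorph hρ R b).measurableEmbedding

lemma IsSimilarityImage.volume_eq (h : IsSimilarityImage ρ R b S S') (hρ : 0 < ρ) :
    (volume : Measure (E d)).restrict S'.K
      = ENNReal.ofReal (ρ ^ d) • (volume.restrict S.K).map (similarity ρ R b) := by
  rw [h.image_K]
  exact volume_restrict_similarity_image hρ R b S.K

lemma IsSimilarityImage.surf_eq (h : IsSimilarityImage ρ R b S S') (hρ : 0 < ρ) :
    surf S'.K = ENNReal.ofReal (ρ ^ (d - 1)) • (surf S.K).map (similarity ρ R b) := by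
  rw [h.image_K]
  exact surf_similarity_image hρ R b S.K

/-- Change of variables on the boundary. -/
lemma IsSimilarityImage.inner_bd (h : IsSimilarityImage ρ R b S S') (hρ : 0 < ρ)
    {f g : L2Bd S.K} {f' g' : L2Bd S'.K} (hf : IsPushM ρ R b f f') (hg : IsPushM ρ R b g g') :
    inner ℝ f' g' = ρ ^ (d - 1) * inner ℝ f g := by
  have := inner_of_ae_comp (measurableEmbedding_similarity hρ R b) (by positivity)
    (h.surf_eq hρ) LinearIsometry.id 1 1 (f := f) (g := g) (f' := f') (g' := g')
    (by filter_upwards [hf] with x hx; simpa using hx)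
    (by filter_upwards [hg] with x hx; simpa using hx)
  simpa using this

lemma IsSimilarityImage.norm_sq_bd (h : IsSimilarityImage ρ R b S S') (hρ : 0 < ρ)
    {f : L2Bd S.K} {f' : L2Bd S'.K} (hf : IsPushM ρ R b f f') :
    ‖f'‖ ^ 2 = ρ ^ (d - 1) * ‖f‖ ^ 2 := by
  rw [← real_inner_self_eq_norm_sq, h.inner_bd hρ hf hf, real_inner_self_eq_norm_sq]

/-- The subtraction of representatives on `∂K'` holds only almost everywhere; it pulls back to `∂K`
because the surface measure of `K'` is a positive multiple of the push-forward. -/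
lemma IsSimilarityImage.pushM_sub (h : IsSimilarityImage ρ R b S S') (hρ : 0 < ρ)
    {f g : L2Bd S.K} {f' g' : L2Bd S'.K} (hf : IsPushM ρ R b f f') (hg : IsPushM ρ R b g g') :
    IsPushM ρ R b (f - g) (f' - g') := by
  have hsub : ∀ᵐ y ∂((surf S.K).map (similarity ρ R b)),
      (f' - g' : L2Bd S'.K) y = f' y - g' y := by
    have h1 := Lp.coeFn_sub f' g'
    refine Measure.AbsolutelyContinuous.ae_le ?_ h1
    rw [h.surf_eq hρ]
    exact Measure.AbsolutelyContinuous.refl _ |>.trans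
      (Measure.absolutelyContinuous_smul (by simpa using pow_pos hρ _))
  have h2 := (measurableEmbedding_similarity hρ R b).ae_map_iff.1 hsub
  filter_upwards [h2, hf, hg, Lp.coeFn_sub f g] with x h3 h4 h5 h6
  rw [h3, h4, h5, h6, Pi.sub_apply]

/-- Push-forward multiplies boundary inner products by one constant and matches the two spaces `M_S`
in both directions. It thus preserves orthogonality and commutes with the projections. -/
lemma IsSimilarityImage.norm_sq_projection (h : IsSimilarityImage ρ R b S S') (hρ : 0 < ρ)
    {f : L2Bd S.K} {f' : L2Bd S'.K} (hf : IsPushM ρ R b f f') :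
    ‖S'.MS.starProjection f'‖ ^ 2 = ρ ^ (d - 1) * ‖S.MS.starProjection f‖ ^ 2 := by
  obtain ⟨p', hp', hpp⟩ := h.MS_fwd _ (S.MS.starProjection_apply_mem f)
  have : S'.MS.starProjection f' = p' := by
    refine (Submodule.eq_starProjection_of_mem_of_inner_eq_zero hp' fun m' hm' => ?_)
    obtain ⟨m, hm, hmm⟩ := h.MS_bwd m' hm'
    rw [h.inner_bd hρ (h.pushM_sub hρ hf hpp) hmm, Submodule.starProjection_inner_eq_zero f m hm,
      mul_zero]
  rw [this, h.norm_sq_bd hρ hpp]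

lemma IsSimilarityImage.norm_sq_grad (h : IsSimilarityImage ρ R b S S') (hρ : 0 < ρ)
    {u : H1 S.K} {u' : H1 S'.K} (hu : IsPushW ρ R b u u') :
    ‖H1.grad u'‖ ^ 2 = ρ ^ d * (ρ⁻¹ * ρ⁻¹) * ‖H1.grad u‖ ^ 2 := by
  rw [← real_inner_self_eq_norm_sq, ← real_inner_self_eq_norm_sq]
  exact inner_of_ae_comp (measurableEmbedding_similarity hρ R b) (by positivity)
    (h.volume_eq hρ) R.toLinearIsometry ρ⁻¹ ρ⁻¹ hu.2.1 hu.2.1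

lemma IsSimilarityImage.norm_sq_val (h : IsSimilarityImage ρ R b S S') (hρ : 0 < ρ)
    {v : Hdiv S.K} {v' : Hdiv S'.K} (hv : IsPushV ρ R b v v') :
    ‖Hdiv.val v'‖ ^ 2 = ρ ^ d * ‖Hdiv.val v‖ ^ 2 := by
  have hv1 : ∀ᵐ x ∂(volume.restrict S.K), Hdiv.val v' (similarity ρ R b x)
      = (1 : ℝ) • R.toLinearIsometry (Hdiv.val v x) := by
    filter_upwards [hv.1] with x hx
    rw [hx, one_smul]
    rfl
  have := inner_of_ae_comp (measurableEmbedding_similarity hρ R b) (by positivity)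
    (h.volume_eq hρ) R.toLinearIsometry 1 1 hv1 hv1
  rwa [real_inner_self_eq_norm_sq, real_inner_self_eq_norm_sq, mul_one, mul_one] at this

lemma IsSimilarityImage.inner_div (h : IsSimilarityImage ρ R b S S') (hρ : 0 < ρ)
    {u : H1 S.K} {u' : H1 S'.K} (hu : IsPushW ρ R b u u')
    {v : Hdiv S.K} {v' : Hdiv S'.K} (hv : IsPushV ρ R b v v') :
    inner ℝ (H1.val u') (Hdiv.div v') = ρ ^ d * ρ⁻¹ * inner ℝ (H1.val u) (Hdiv.div v) := by
  have := inner_of_ae_comp (measurableEmbedding_similarity hρ R b) (by positivity)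
    (h.volume_eq hρ) LinearIsometry.id 1 ρ⁻¹ (f := H1.val u) (g := Hdiv.div v)
    (f' := H1.val u') (g' := Hdiv.div v')
    (by filter_upwards [hu.1] with x hx; simpa using hx) hv.2.1
  rwa [one_mul] at this

end Transport

/-! ### Balance of the powers of `ρ` -/

/-- The arithmetic of the scaling by `ρ`, where `s = ρ ^ d` and `σ = ρ ^ (d - 1)`. -/
lemma scaled_bounds {C h h' ρ s σ Q P P' g g' t t' p p' m m' : ℝ} (hC : 0 ≤ C) (hh : 0 < h)
    (hρ : 0 < ρ) (hσ : 0 < σ) (hQ : 0 ≤ Q) (hP : 0 ≤ P) (hs : s = ρ * σ) (hh' : h' = ρ * h)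
    (hP' : P' = σ * P) (hg' : g' = s * (ρ⁻¹ * ρ⁻¹) * g) (ht' : t' = σ * t) (hp' : p' = s * p)
    (hm' : m' = σ * m) (hg : g ≤ C * (Q * ρ / σ + P)) (ht : t ≤ C * (Q * ρ / σ + P))
    (hp : p ≤ C * (Q * ρ / σ + P)) (hm : m ≤ C * (Q * ρ / σ + P)) :
    g' + h'⁻¹ * t' ≤ (C * (1 + h) * (1 + h⁻¹ + (h ^ 2)⁻¹ * (1 + h)) + 1) * (Q + h'⁻¹ * P') ∧
      (h' ^ 2)⁻¹ * (p' + h' * m')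
        ≤ (C * (1 + h) * (1 + h⁻¹ + (h ^ 2)⁻¹ * (1 + h)) + 1) * (Q + h'⁻¹ * P') := by
  subst hh' hP' hg' ht' hp' hm' hs
  set Θ := Q + (ρ * h)⁻¹ * (σ * P) with hΘ
  have hΘ0 : 0 ≤ Θ := by positivity
  -- `σ / ρ = ρ^(d-2)` is the common factor of all terms. It turns the residual bound `Q ρ / σ` back
  -- into `Q`, and `P` into `h` times the projection term of `Θ`; hence the factor `1 + h`.
  have key {X : ℝ} (hX : X ≤ C * (Q * ρ / σ + P)) : σ / ρ * X ≤ C * (1 + h) * Θ := by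
    have hP' : 0 ≤ (ρ * h)⁻¹ * (σ * P) := by positivity
    calc σ / ρ * X ≤ σ / ρ * (C * (Q * ρ / σ + P)) := by gcongr
      _ = C * (Q + h * ((ρ * h)⁻¹ * (σ * P))) := by field_simp
      _ ≤ C * ((1 + h) * Θ) := by
        refine mul_le_mul_of_nonneg_left ?_ hC
        rw [hΘ]
        linarith [mul_nonneg hh.le hQ]
      _ = C * (1 + h) * Θ := by ring
  have k1 := key hg
  have k2 := key ht
  have k3 := key hp
  have k4 := key hm
  set D := C * (1 + h) * Θ with hD
  have hD0 : 0 ≤ D := by positivity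
  constructor
  · calc _ = σ / ρ * g + h⁻¹ * (σ / ρ * t) := by field_simp
      _ ≤ D + h⁻¹ * D := by gcongr
      _ ≤ D * (1 + h⁻¹ + (h ^ 2)⁻¹ * (1 + h)) + Θ := by
        have : 0 ≤ (h ^ 2)⁻¹ * (1 + h) * D := by positivity
        linarith
      _ = _ := by rw [hD]; ring
  · calc _ = (h ^ 2)⁻¹ * (σ / ρ * p + h * (σ / ρ * m)) := by field_simp
      _ ≤ (h ^ 2)⁻¹ * (D + h * D) := by gcongr
      _ ≤ D * (1 + h⁻¹ + (h ^ 2)⁻¹ * (1 + h)) + Θ := by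
        have : 0 ≤ (1 + h⁻¹) * D := by positivity
        linarith
      _ = _ := by rw [hD]; ring

/-- Both terms of the residual scale by `σ`: the volume term gains `ρ^d` and loses one `ρ` to the
divergence. -/
lemma scaled_residual {ρ σ Q x x' y y' z n n' : ℝ} (hρ : 0 < ρ) (hσ : 0 < σ)
    (hx : x' = ρ * σ * ρ⁻¹ * x) (hy : y' = σ * y) (hz : z = x' - y') (hn : n' = ρ * σ * n)
    (h : z ^ 2 ≤ Q * n') : (x - y) ^ 2 ≤ Q * ρ / σ * n := by
  have hz' : z = σ * (x - y) := by
    rw [hz, hx, hy]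
    field_simp
  rw [hz', hn] at h
  rw [div_mul_eq_mul_div, le_div_iff₀ hσ]
  refine le_of_mul_le_mul_left ?_ hσ
  linarith

lemma pow_eq_mul_pow_pred (hd : 1 ≤ d) (ρ : ℝ) : ρ ^ d = ρ * ρ ^ (d - 1) := by
  rw [← pow_succ', Nat.sub_add_cancel hd]

section Transport

variable {ρ : ℝ} {R : E d ≃ₗᵢ[ℝ] E d} {b : E d} {S S' : LocalSpaces d}

set_option maxHeartbeats 1000000 in
/-- The residual of the constitutive relation on `K'`, transported to `K`. -/
lemma IsSimilarityImage.residual_sq_le (h : IsSimilarityImage ρ R b S S') (hρ : 0 < ρ)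
    (hd : 1 ≤ d) {c : E d → Matrix (Fin d) (Fin d) ℝ} (hc : IsAdmissibleTensor S'.K c)
    {q : Hdiv S'.K} {u : H1 S.K} {u' : H1 S'.K} (hu : IsPushW ρ R b u u') {m : L2Bd S.K}
    {m' : L2Bd S'.K} (hm : IsPushM ρ R b m m') (hrel : ConstitutiveRelation S' c q u' m')
    {v : Hdiv S.K} (hv : v ∈ S.V) :
    (inner ℝ (H1.val u) (Hdiv.div v) - inner ℝ m (Hdiv.ntrace v)) ^ 2
      ≤ lambdaMax S'.K c * cForm S'.K c (Hdiv.val q) (Hdiv.val q) * ρ / ρ ^ (d - 1)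
        * ‖Hdiv.val v‖ ^ 2 := by
  have : Nonempty (Fin d) := ⟨⟨0, hd⟩⟩
  have : Nontrivial (E d) := inferInstance
  -- The tensor and the flux stay on `K'`; only the test field is moved there.
  obtain ⟨v', hv', hpv⟩ := h.V_fwd v hv
  have h1 := (cForm_sq_le hc (Hdiv.val q) (Hdiv.val v')).2
  have h2 := h.inner_div hρ hu hpv
  have h3 : inner ℝ m' (Hdiv.ntrace v') = ρ ^ (d - 1) * inner ℝ m (Hdiv.ntrace v) :=
    h.inner_bd hρ hm hpv.2.2
  have h4 := h.norm_sq_val hρ hpv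
  rw [pow_eq_mul_pow_pred hd] at h2 h4
  exact scaled_residual hρ (pow_pos hρ _) h2 h3 (hrel v' hv') h4 h1

lemma IsSimilarityImage.average_eq (h : IsSimilarityImage ρ R b S S') (hρ : 0 < ρ)
    {m : L2Bd S.K} {m' : L2Bd S'.K} (hm : IsPushM ρ R b m m') :
    ⨍ y, m' y ∂(surf S'.K) = ⨍ y, m y ∂(surf S.K) :=
  (average_smul_map (measurableEmbedding_similarity hρ R b) (pow_pos hρ _) (h.surf_eq hρ) _).trans
    (average_congr hm)

lemma IsSimilarityImage.integral_sub_sq_volume (h : IsSimilarityImage ρ R b S S') (hρ : 0 < ρ)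
    {u : H1 S.K} {u' : H1 S'.K} (hu : IsPushW ρ R b u u') {a a' : ℝ}
    (ha : a' = a) :
    ∫ x in S'.K, (H1.val u' x - a') ^ 2 = ρ ^ d * ∫ x in S.K, (H1.val u x - a) ^ 2 := by
  subst ha
  rw [integral_smul_map (measurableEmbedding_similarity hρ R b) (by positivity) (h.volume_eq hρ)]
  congr 1
  refine integral_congr_ae ?_
  filter_upwards [hu.1] with x hx
  rw [hx]

lemma IsSimilarityImage.integral_sub_sq_surf (h : IsSimilarityImage ρ R b S S') (hρ : 0 < ρ)
    {m : L2Bd S.K} {m' : L2Bd S'.K} (hm : IsPushM ρ R b m m') {a a' : ℝ}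
    (ha : a' = a) :
    ∫ x, (m' x - a') ^ 2 ∂(surf S'.K) = ρ ^ (d - 1) * ∫ x, (m x - a) ^ 2 ∂(surf S.K) := by
  subst ha
  rw [integral_smul_map (measurableEmbedding_similarity hρ R b) (by positivity) (h.surf_eq hρ)]
  congr 1
  refine integral_congr_ae ?_
  filter_upwards [hm] with x hx
  rw [hx]

set_option maxHeartbeats 1000000 in
/-- Estimates on the reference element carry over to similar elements. -/
lemma IsSimilarityImage.seminorm_bounds (hsim : IsSimilarityImage ρ R b S S') (hρ : 0 < ρ)
    (hd : 1 ≤ d) (hK : 0 < Metric.diam S.K) {C : ℝ} (hC : 0 ≤ C)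
    (hbound : ∀ u ∈ S.W, ∀ uhat ∈ S.M, ∀ a : ℝ, 0 ≤ a →
      (∀ v ∈ S.V, (inner ℝ (H1.val u) (Hdiv.div v) - inner ℝ uhat (Hdiv.ntrace v)) ^ 2
        ≤ a * ‖Hdiv.val v‖ ^ 2) →
      ‖H1.grad u‖ ^ 2 ≤ C * (a + ‖S.MS.starProjection (H1.trace u - uhat)‖ ^ 2) ∧
      ‖H1.trace u - uhat‖ ^ 2 ≤ C * (a + ‖S.MS.starProjection (H1.trace u - uhat)‖ ^ 2) ∧
      ∫ x in S.K, (H1.val u x - ⨍ y, uhat y ∂(surf S.K)) ^ 2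
        ≤ C * (a + ‖S.MS.starProjection (H1.trace u - uhat)‖ ^ 2) ∧
      ∫ x, (uhat x - ⨍ y, uhat y ∂(surf S.K)) ^ 2 ∂(surf S.K)
        ≤ C * (a + ‖S.MS.starProjection (H1.trace u - uhat)‖ ^ 2))
    {c : E d → Matrix (Fin d) (Fin d) ℝ} (hc : IsAdmissibleTensor S'.K c) {q : Hdiv S'.K}
    {u' : H1 S'.K} (hu' : u' ∈ S'.W) {uhat' : L2Bd S'.K} (huhat' : uhat' ∈ S'.M)
    (hrel : ConstitutiveRelation S' c q u' uhat') :
    seminormH1Sq u' uhat' ≤ (C * (1 + Metric.diam S.K) * (1 + (Metric.diam S.K)⁻¹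
        + (Metric.diam S.K ^ 2)⁻¹ * (1 + Metric.diam S.K)) + 1) * Theta S' c q u' uhat' ∧
      (Metric.diam S'.K ^ 2)⁻¹ * seminormPFSq u' uhat'
        ≤ (C * (1 + Metric.diam S.K) * (1 + (Metric.diam S.K)⁻¹
        + (Metric.diam S.K ^ 2)⁻¹ * (1 + Metric.diam S.K)) + 1) * Theta S' c q u' uhat' := by
  have : Nonempty (Fin d) := ⟨⟨0, hd⟩⟩
  obtain ⟨u, hu, hpu⟩ := hsim.W_bwd u' hu'
  obtain ⟨uhat, huhat, hpm⟩ := hsim.M_bwd uhat' huhat'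
  have hdiam : Metric.diam S'.K = ρ * Metric.diam S.K := by
    rw [hsim.image_K, diam_similarity_image hρ]
  have hQ := (cForm_sq_le hc (Hdiv.val q) (Hdiv.val q)).1
  have hσ : 0 < ρ ^ (d - 1) := pow_pos hρ _
  have hJ : IsPushM ρ R b (H1.trace u - uhat) (H1.trace u' - uhat') :=
    hsim.pushM_sub hρ hpu.2.2 hpm
  obtain ⟨b1, b2, b3, b4⟩ := hbound u hu uhat huhat _
    (div_nonneg (mul_nonneg hQ hρ.le) hσ.le)
    fun v hv => hsim.residual_sq_le hρ hd hc hpu hpm hrel hv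
  have hav := hsim.average_eq hρ hpm
  exact scaled_bounds hC hK hρ hσ hQ (sq_nonneg _) (pow_eq_mul_pow_pred hd ρ) hdiam
    (hsim.norm_sq_projection hρ hJ) (hsim.norm_sq_grad hρ hpu) (hsim.norm_sq_bd hρ hJ)
    (hsim.integral_sub_sq_volume hρ hpu hav) (hsim.integral_sub_sq_surf hρ hpm hav) b1 b2 b3 b4

end Transport

end HDG

end

theorem theorem2p3 (d : ℕ) (hd : 2 ≤ d) (S : HDG.LocalSpaces d)
    (hK : HDG.IsPolyhedralElement S.K) :
    ∃ C : ℝ, 0 < C ∧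
      ∀ (Vt : Submodule ℝ (HDG.Hdiv S.K)) (Wt : Submodule ℝ (HDG.H1 S.K)),
        HDG.IsMDecomposition S Vt Wt → HDG.IsStabilizationSubspace S Wt →
        ∀ (ρ : ℝ) (R : HDG.E d ≃ₗᵢ[ℝ] HDG.E d) (b : HDG.E d) (S' : HDG.LocalSpaces d),
          0 < ρ → HDG.IsSimilarityImage ρ R b S S' →
          ∀ c : HDG.E d → Matrix (Fin d) (Fin d) ℝ, HDG.IsAdmissibleTensor S'.K c →
            ∀ q ∈ S'.V, ∀ u ∈ S'.W, ∀ uhat ∈ S'.M,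
              HDG.ConstitutiveRelation S' c q u uhat →
                HDG.seminormH1Sq u uhat ≤ C * HDG.Theta S' c q u uhat ∧
                (Metric.diam S'.K ^ 2)⁻¹ * HDG.seminormPFSq u uhat
                  ≤ C * HDG.Theta S' c q u uhat := by
  -- The constant is fixed before `Vt` and `Wt`. The reference bound mentions neither, so any one
  -- decomposition yields a constant valid for all; if there is none, the claim is vacuous.
  by_cases hex : ∃ (Vt : Submodule ℝ (HDG.Hdiv S.K)) (Wt : Submodule ℝ (HDG.H1 S.K)),
      HDG.IsMDecomposition S Vt Wt ∧ HDG.IsStabilizationSubspace S Wt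
  swap
  · exact ⟨1, one_pos, fun Vt Wt hM hS => (hex ⟨Vt, Wt, hM, hS⟩).elim⟩
  obtain ⟨Vt, Wt, hM, hS⟩ := hex
  have hd1 : 1 ≤ d := one_le_two.trans hd
  obtain ⟨C, hC, hbound⟩ := HDG.exists_reference_bound hd1 hK hM hS
  have hh := hK.diam_pos hd1
  -- The last summand keeps the constant positive when `C = 0`.
  refine ⟨C * (1 + Metric.diam S.K) * (1 + (Metric.diam S.K)⁻¹
    + (Metric.diam S.K ^ 2)⁻¹ * (1 + Metric.diam S.K)) + 1, by positivity, ?_⟩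
  intro _ _ _ _ ρ R b S' hρ hsim c hc q _ u hu uhat huhat hrel
  exact hsim.seminorm_bounds hρ hd1 hh hC hbound hc hu huhat hrel
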